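/- Let $W$ be a complex Gaussian random measure on $\mathbb R$ with Lebesgue control measure, i.e. the variables $W(A)\in\mathbb C$ ($A$ Borel of finite Lebesgue measure) are centred and jointly Gaussian, with $W(-A)=\overline{W(A)}$ almost surely and $\mathbb E[W(A)\overline{W(A')}]=\mathrm{Leb}(A\cap A')$. For $H\in(0,1)$ put $$c_H=\Big(\frac{2\cos(\pi H)\,\Gamma(2-2H)}{H(1-2H)}\Big)^{1/2},\qquad c_{1/2}=\sqrt{2\pi}\ \text{ (by continuity)}.$$ Let $h:[0,1]\to(0,1)$ be of class $C^2$ on $[0,1]$, and let $B^h=(B^h_t)_{t\in[0,1]}$ be the multifractional Brownian motion with functional parameter $h$, i.e. the real-valued process with, for each $t\in[0,1]$, almost surely $$B^h_t=\frac1{c_{h(t)}}\int_{\mathbb R}\frac{e^{itx}-1}{|x|^{h(t)+1/2}}\,W(dx),$$ the integral being the $L^2$-limit of the elementary integrals of simple functions. Let $h_{\min}=\min_{t\in[0,1]}h(t)$ and assume that $$\mathcal M_h:=\{t\in[0,1]:h(t)=h_{\min}\}=\Big(\bigcup_{i=1}^q[a_i,b_i]\Big)\cup\Big(\bigcup_{j=1}^m\{x_j\}\Big),\qquad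 (q,m)\in\mathbb N^2\setminus\{(0,0)\},$$ where $\mathbb N=\{0,1,2,\dots\}$, $a_i<b_i$, the intervals $[a_i,b_i]$ are pairwise disjoint and contain none of the points $x_j$. If $q=0$, assume moreover that condition ($\mathscr A$) holds: there are positive integers $p_1,\dots,p_m$ such that, for every $j$, $h$ is $p_j$ times continuously left and right differentiable at $x_j$ and $$p_j=\min\{p\ge1:h^{(p)}_l(x_j)\neq0\}=\min\{p\ge1:h^{(p)}_r(x_j)\neq0\},$$ where $h^{(p)}_l$ and $h^{(p)}_r$ denote the $p$th left and right derivatives (at $x_j=0$ only the requirement on the right derivatives is made, at $x_j=1$ only that on the left derivatives). For $k=1,2$ let $$V(B^h;k)^n=\sum_{i=0}^{n-k}\big(B^h_{(i+k)/n}-B^h_{i/n}\big)^2,\qquad S_n(B^h)=\frac{V(B^h;1)^n}{V(B^h;2)^n}.$$ Then, as $n\to\infty$, in probability, $$S_n(B^h)\longrightarrow\Big(\frac12\Big)^{2h_{\min}}\qquad\text{and}\qquad \widehat h_{\min}:=-\frac{\ln(S_n(B^h))}{2\ln 2}\longrightarrow h_{\min}.$$ -/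

import Mathlib

open MeasureTheory ProbabilityTheory Filter Topology Set

noncomputable section

namespace MultifracBM

/-- Complex Gaussian random measure `W` on `ℝ` (with Hermitian symmetry), with Lebesgue control
measure, over the probability space `(Ω, P)`. Only the values on Borel sets of finite Lebesgue
measure matter. (Almost sure additivity follows from `covariance`, as
`E|W(A ∪ A') - W(A) - W(A')|² = 0` for disjoint `A`, `A'`; likewise `hermitian` and `covariance`
give `E[W(A) W(A')] = |A ∩ (-A')|`.) -/
structure IsComplexGaussianMeasure {Ω : Type*} [MeasurableSpace Ω] (P : Measure Ω)
    (W : Set ℝ → Ω → ℂ) : Prop where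
  /-- the values of `W` are jointly Gaussian (as vectors of the real vector space `ℂ`) -/
  gaussian : IsGaussianProcess
    (fun A : {A : Set ℝ // MeasurableSet A ∧ volume A < ⊤} => W A.1) P
  /-- the values of `W` are centred -/
  centred : ∀ A : Set ℝ, MeasurableSet A → volume A < ⊤ → ∫ ω, W A ω ∂P = 0
  /-- `W(-A)` is the complex conjugate of `W(A)` -/
  hermitian : ∀ A : Set ℝ, MeasurableSet A → volume A < ⊤ →
    ∀ᵐ ω ∂P, W (Neg.neg ⁻¹' A) ω = (starRingEnd ℂ) (W A ω)
  /-- `E[W(A) conj(W(A'))]` is the Lebesgue measure of `A ∩ A'` -/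
  covariance : ∀ A A' : Set ℝ, MeasurableSet A → volume A < ⊤ →
    MeasurableSet A' → volume A' < ⊤ →
    ∫ ω, W A ω * (starRingEnd ℂ) (W A' ω) ∂P = (volume.real (A ∩ A') : ℂ)

/-- The elementary stochastic integral `∫ φ dW = ∑ z, z W({φ = z})` of a simple function. -/
def simpleIntegral {Ω : Type*} (W : Set ℝ → Ω → ℂ) (φ : SimpleFunc ℝ ℂ) (ω : Ω) : ℂ :=
  ∑ z ∈ φ.range, z * W (φ ⁻¹' {z}) ω

/-- `Y = ∫ f dW`: the function `f` is in `L²(ℝ; ℂ)`, and `Y` is the limit in `L²(P)` of the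
elementary integrals of square integrable simple functions that converge to `f` in `L²`. -/
def IsStochIntegral {Ω : Type*} [MeasurableSpace Ω] (P : Measure Ω)
    (W : Set ℝ → Ω → ℂ) (f : ℝ → ℂ) (Y : Ω → ℂ) : Prop :=
  MemLp f 2 (volume : Measure ℝ) ∧ MemLp Y 2 P ∧
    ∃ φ : ℕ → SimpleFunc ℝ ℂ,
      (∀ k, MemLp (φ k) 2 (volume : Measure ℝ)) ∧
      Tendsto (fun k => eLpNorm (fun u => φ k u - f u) 2 (volume : Measure ℝ)) atTop (𝓝 0) ∧
      Tendsto (fun k => eLpNorm (fun ω => simpleIntegral W (φ k) ω - Y ω) 2 P) atTop (𝓝 0)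

/-- The normalising constant `c_H = (2 cos(πH) Γ(2 - 2H) / (H (1 - 2H)))^{1/2}`, `0 < H < 1`,
extended by continuity to `H = 1/2`, where the formula reads `0 / 0` and the limit is
`√(2π)`. -/
def normConst (H : ℝ) : ℝ :=
  if H = 1 / 2 then √(2 * Real.pi)
  else √(2 * Real.cos (Real.pi * H) * Real.Gamma (2 - 2 * H) / (H * (1 - 2 * H)))

/-- The integrand `x ↦ (exp(i t x) - 1) / |x|^{H + 1/2}`. -/
def harmonizableKernel (t H : ℝ) (u : ℝ) : ℂ :=
  (Complex.exp (Complex.I * (t : ℂ) * (u : ℂ)) - 1) / ((|u| ^ (H + 1 / 2) : ℝ) : ℂ)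

/-- `B` is (on the time interval `[0,1]`) the normalised multifractional Brownian motion with
functional parameter `h` driven by `W`: for every `t`, almost surely,
`B_t = (1 / c_{h(t)}) ∫ (exp(i t x) - 1) / |x|^{h(t) + 1/2} W(dx)`. -/
def IsMultifracBM {Ω : Type*} [MeasurableSpace Ω] (P : Measure Ω)
    (W : Set ℝ → Ω → ℂ) (h : ℝ → ℝ) (B : ℝ → Ω → ℝ) : Prop :=
  ∀ t ∈ Icc (0 : ℝ) 1, ∃ Y : Ω → ℂ,
    IsStochIntegral P W (harmonizableKernel t (h t)) Y ∧
    ∀ᵐ ω ∂P, (B t ω : ℂ) = 1 / (normConst (h t) : ℂ) * Y ω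

/-- `h_min`, the minimum of `h` on `[0,1]` (attained when `h` is continuous there). -/
def hmin (h : ℝ → ℝ) : ℝ := sInf (h '' Icc (0 : ℝ) 1)

/-- The set of minimisers of `h` in `[0,1]`. -/
def minSet (h : ℝ → ℝ) : Set ℝ := {t | t ∈ Icc (0 : ℝ) 1 ∧ h t = hmin h}

/-- The set of minimisers is the union of the pairwise disjoint nondegenerate intervals
`[a i, b i]`, `i < q`, and of the points `x j`, `j < m`, outside these intervals. -/
structure MinSetForm (h : ℝ → ℝ) {q m : ℕ} (a b : Fin q → ℝ) (x : Fin m → ℝ) : Prop where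
  not_both_zero : (q, m) ≠ (0, 0)
  lt : ∀ i, a i < b i
  disjoint : ∀ i i', i ≠ i' → Disjoint (Icc (a i) (b i)) (Icc (a i') (b i'))
  notMem : ∀ j i, x j ∉ Icc (a i) (b i)
  eq : minSet h = (⋃ i, Icc (a i) (b i)) ∪ ⋃ j, {x j}

/-- At each `x j` the function `h` is `p j ≥ 1` times continuously left and right differentiable,
and `p j` is the order of the first nonzero left derivative and of the first nonzero right
derivative. At an end point of `[0,1]` only the derivatives from inside `[0,1]` are meant. -/
def ConditionA (h : ℝ → ℝ) {m : ℕ} (x : Fin m → ℝ) : Prop :=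
  ∃ p : Fin m → ℕ, ∀ j, 0 < p j ∧
    (0 < x j → ContDiffWithinAt ℝ (p j) h (Iic (x j)) (x j) ∧
      IsLeast {k : ℕ | 0 < k ∧ iteratedDerivWithin k h (Iic (x j)) (x j) ≠ 0} (p j)) ∧
    (x j < 1 → ContDiffWithinAt ℝ (p j) h (Ici (x j)) (x j) ∧
      IsLeast {k : ℕ | 0 < k ∧ iteratedDerivWithin k h (Ici (x j)) (x j) ≠ 0} (p j))

/-- `V(B;k)^n = ∑_{i=0}^{n-k} (B_{(i+k)/n} - B_{i/n})²`. -/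
def quadVar {Ω : Type*} (B : ℝ → Ω → ℝ) (k n : ℕ) (ω : Ω) : ℝ :=
  ∑ i ∈ Finset.range (n + 1 - k),
    (B (((i : ℝ) + (k : ℝ)) / (n : ℝ)) ω - B ((i : ℝ) / (n : ℝ)) ω) ^ 2

/-- The ratio statistic `S_n(B) = V(B;1)^n / V(B;2)^n`. -/
def ratioStat {Ω : Type*} (B : ℝ → Ω → ℝ) (n : ℕ) (ω : Ω) : ℝ :=
  quadVar B 1 n ω / quadVar B 2 n ω

/-- The estimator `-ln(S_n(B)) / (2 ln 2)`. -/
def hminEstimator {Ω : Type*} (B : ℝ → Ω → ℝ) (n : ℕ) (ω : Ω) : ℝ :=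
  -Real.log (ratioStat B n ω) / (2 * Real.log 2)

end MultifracBM

end

/-! The quadratic variations `V(B; k)^n` are sums of squares in a Gaussian space, so that their
mean and variance determine their behaviour: by Isserlis' formula the variance is twice the sum of
the squared covariances of the increments (`IsGaussianSpace.variance_sum_sq`), and Chebyshev's
inequality gives a law of large numbers as soon as this is negligible with respect to the square
of the mean (`IsGaussianSpace.tendstoInMeasure_sum_sq`). The space in question is the
`L²`-closure of the real span of the values of `W`, which contains every `B t`; the isometry
property of the stochastic integral turns covariances into inner products in `L²(ℝ; ℂ)`.

The covariances are computed by freezing the Hurst index at the left end point of each increment.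
As `h` and the kernel are Lipschitz in the relevant sense, this costs `O(1 / n)` in `L²`, which is
`n ^ (-h (i / n))` times a negative power of `n` because `h` stays away from `1`. With frozen
indices, scaling gives `n ^ (-(h (i / n) + h (j / n)))` times a covariance of increments of
fractional Brownian motion at distance `i - j`
(`IsMultifracBM.exists_covariance_approx`). By the Riemann-Lebesgue lemma, uniformly in
the Hurst index, the latter is small away from the diagonal (`eventually_norm_spectralCov_le`).

It remains to see where the weights `n ^ (-2 h (i / n))` concentrate. By continuity of `h` a
positive proportion of the indices satisfies `h (i / n) ≤ h_min + η`, so the sum of the weights is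
at least a multiple of `n ^ (1 - 2 h_min - 2 η)` for every `η > 0`, while the indices with
`h (i / n) ≥ h_min + ε` contribute at most `n ^ (1 - 2 h_min - 2 ε)`. Hence weighted averages of
continuous functions of `h (i / n)` converge to their value at `h_min`
(`tendsto_weighted_average`), and a band of fixed width around the diagonal is negligible in the
variance (`tendsto_sum_sq_div_gridSum_sq`). So `V(B; k)^n`, divided by the sum of
the weights, converges in probability to `k ^ (2 h_min)` times a positive constant which does not
depend on `k`, and the ratio for `k = 1` and `k = 2` tends to `(1 / 2) ^ (2 h_min)`. -/

namespace MultifracBM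

/-! ### Gaussian spaces and the fluctuations of sums of squares -/

section GaussianSpace

variable {Ω : Type*} [MeasurableSpace Ω] {P : Measure Ω}

lemma integral_pow_four_gaussianReal (v : NNReal) :
    ∫ x, x ^ 4 ∂(gaussianReal 0 v) = 3 * (v : ℝ) ^ 2 := by
  have hmgf : mgf id (gaussianReal 0 v) = fun t => Real.exp ((v : ℝ) * t ^ 2 / 2) := by
    rw [mgf_id_gaussianReal]; ext t; simp
  have hE : ∀ t : ℝ, HasDerivAt (fun t : ℝ => Real.exp ((v : ℝ) * t ^ 2 / 2))
      (v * t * Real.exp ((v : ℝ) * t ^ 2 / 2)) t := by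
    intro t
    have h1 : HasDerivAt (fun t : ℝ => (v : ℝ) * t ^ 2 / 2) (v * t) t := by
      have := (((hasDerivAt_id t).pow 2).const_mul (v : ℝ)).div_const 2
      convert! this using 1
      simp; ring
    convert! h1.exp using 1
    ring
  have h := iteratedDeriv_mgf_zero (X := id) (μ := gaussianReal 0 v)
    (by rw [integrableExpSet_id_gaussianReal]; simp) 4
  have hL : ∫ x, x ^ 4 ∂(gaussianReal 0 v) = (gaussianReal 0 v)[id ^ 4] := by simp
  have hp : ∀ (p p' : ℝ → ℝ), (∀ t, HasDerivAt p (p' t) t) →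
      deriv (fun t => p t * Real.exp ((v : ℝ) * t ^ 2 / 2)) =
        fun t => (p' t + p t * (v * t)) * Real.exp ((v : ℝ) * t ^ 2 / 2) := by
    intro p p' hpp
    funext t
    exact ((hpp t).mul (hE t)).deriv.trans (by ring)
  have d1 : deriv (fun t : ℝ => Real.exp ((v : ℝ) * t ^ 2 / 2)) =
      fun t => (v * t) * Real.exp ((v : ℝ) * t ^ 2 / 2) := by
    funext t; exact (hE t).deriv
  have p1 : ∀ t : ℝ, HasDerivAt (fun t : ℝ => (v : ℝ) * t) v t := fun t => by
    simpa using (hasDerivAt_id t).const_mul (v : ℝ)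
  have p2 : ∀ t : ℝ, HasDerivAt (fun t : ℝ => (v : ℝ) + v * t * (v * t)) (2 * v ^ 2 * t) t :=
    fun t => by
      convert! ((p1 t).mul (p1 t)).const_add (v : ℝ) using 1
      ring
  have p3 : ∀ t : ℝ, HasDerivAt
      (fun t : ℝ => 2 * (v : ℝ) ^ 2 * t + (v + v * t * (v * t)) * (v * t))
      (2 * v ^ 2 + (2 * v ^ 2 * t * (v * t) + (v + v * t * (v * t)) * v)) t := fun t => by
    convert! ((hasDerivAt_id t).const_mul (2 * (v : ℝ) ^ 2)).add ((p2 t).mul (p1 t)) using 1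
    simp
  rw [hL, ← h, hmgf, iteratedDeriv_eq_iterate]
  simp only [Function.iterate_succ, Function.iterate_zero, Function.comp_apply, id]
  rw [d1, hp _ _ p1, hp _ _ p2, hp _ _ p3]
  simp
  ring

/-- A Gaussian space: a real vector space of random variables, each of which is centred Gaussian
(possibly degenerate). -/
def IsGaussianSpace (P : Measure Ω) (G : Submodule ℝ (Ω → ℝ)) : Prop :=
  ∀ X ∈ G, ∃ v : NNReal, HasLaw X (gaussianReal 0 v) P

namespace IsGaussianSpace

variable {G : Submodule ℝ (Ω → ℝ)} {X Y : Ω → ℝ}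

lemma memLp (hG : IsGaussianSpace P G) (hX : X ∈ G) {p : ENNReal} (hp : p ≠ ⊤) :
    MemLp X p P := by
  obtain ⟨v, hv⟩ := hG X hX
  have h := memLp_id_gaussianReal' (μ := 0) (v := v) p hp
  rw [← hv.map_eq] at h
  exact (memLp_map_measure_iff (by fun_prop) hv.aemeasurable).1 h

lemma integral_pow_four (hG : IsGaussianSpace P G) (hX : X ∈ G) :
    ∫ ω, X ω ^ 4 ∂P = 3 * (∫ ω, X ω ^ 2 ∂P) ^ 2 := by
  obtain ⟨v, hv⟩ := hG X hX
  have h2 : ∫ ω, X ω ^ 2 ∂P = v := by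
    have h1 := hv.variance_eq
    rw [variance_id_gaussianReal, variance_eq_integral hv.aemeasurable, hv.integral_eq] at h1
    simpa using h1
  have h4 : ∫ ω, X ω ^ 4 ∂P = ∫ x, x ^ 4 ∂(gaussianReal 0 v) :=
    hv.integral_comp (f := fun x : ℝ => x ^ 4) (by fun_prop)
  rw [h4, h2, integral_pow_four_gaussianReal]

lemma integrable_mul (hG : IsGaussianSpace P G) (hX : X ∈ G) (hY : Y ∈ G) :
    Integrable (fun ω => X ω * Y ω) P :=
  (hG.memLp hX (p := 2) (by simp)).integrable_mul (hG.memLp hY (p := 2) (by simp))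

lemma memLp_sq (hG : IsGaussianSpace P G) (hX : X ∈ G) : MemLp (fun ω => X ω ^ 2) 2 P := by
  have h := hG.memLp hX (p := 4) (by simp)
  have := h.mul (p := 4) (q := 4) (r := 2) (hf := h) (hpqr := ⟨by
    rw [← two_mul, ← div_eq_mul_inv]
    rw [ENNReal.div_eq_inv_mul]
    rw [show (4 : ENNReal) = 2 * 2 by norm_num, ENNReal.mul_inv (by simp) (by simp), mul_assoc,
      ENNReal.inv_mul_cancel (by simp) (by simp), mul_one]⟩)
  convert! this using 1
  ext ω
  exact pow_two _

lemma integrable_sq_mul_sq (hG : IsGaussianSpace P G) (hX : X ∈ G) (hY : Y ∈ G) :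
    Integrable (fun ω => X ω ^ 2 * Y ω ^ 2) P :=
  (hG.memLp_sq hX).integrable_mul (hG.memLp_sq hY)

lemma integrable_pow_four (hG : IsGaussianSpace P G) (hX : X ∈ G) :
    Integrable (fun ω => X ω ^ 4) P := by
  convert! hG.integrable_sq_mul_sq hX hX using 2
  ring

/-- Isserlis' formula for squares, obtained by polarisation from the fourth moments of
`X + Y` and `X - Y`. -/
lemma integral_sq_mul_sq (hG : IsGaussianSpace P G) (hX : X ∈ G) (hY : Y ∈ G) :
    ∫ ω, X ω ^ 2 * Y ω ^ 2 ∂P =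
      (∫ ω, X ω ^ 2 ∂P) * (∫ ω, Y ω ^ 2 ∂P) + 2 * (∫ ω, X ω * Y ω ∂P) ^ 2 := by
  have hXX : Integrable (fun ω => X ω ^ 2) P := by
    simpa [pow_two] using hG.integrable_mul hX hX
  have hYY : Integrable (fun ω => Y ω ^ 2) P := by
    simpa [pow_two] using hG.integrable_mul hY hY
  have hXY := hG.integrable_mul hX hY
  have h1 := hG.integral_pow_four (G.add_mem hX hY)
  have h2 := hG.integral_pow_four (G.sub_mem hX hY)
  have h3 := hG.integral_pow_four hX
  have h4 := hG.integral_pow_four hY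
  have i1 := hG.integrable_pow_four (G.add_mem hX hY)
  have i2 := hG.integrable_pow_four (G.sub_mem hX hY)
  have i3 := hG.integrable_pow_four hX
  have i4 := hG.integrable_pow_four hY
  have s1 : ∫ ω, (X + Y) ω ^ 2 ∂P =
      ∫ ω, X ω ^ 2 ∂P + 2 * ∫ ω, X ω * Y ω ∂P + ∫ ω, Y ω ^ 2 ∂P := by
    rw [← integral_const_mul, ← integral_add hXX (hXY.const_mul 2), ← integral_add _ hYY]
    · congr 1; ext ω; simp only [Pi.add_apply]; ring
    · exact hXX.add (hXY.const_mul 2)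
  have s2 : ∫ ω, (X - Y) ω ^ 2 ∂P =
      ∫ ω, X ω ^ 2 ∂P - 2 * ∫ ω, X ω * Y ω ∂P + ∫ ω, Y ω ^ 2 ∂P := by
    rw [← integral_const_mul, ← integral_sub hXX (hXY.const_mul 2), ← integral_add _ hYY]
    · congr 1; ext ω; simp only [Pi.sub_apply]; ring
    · exact hXX.sub (hXY.const_mul 2)
  have key : ∫ ω, X ω ^ 2 * Y ω ^ 2 ∂P = (1 / 12) * (∫ ω, (X + Y) ω ^ 4 ∂P +
      ∫ ω, (X - Y) ω ^ 4 ∂P - 2 * ∫ ω, X ω ^ 4 ∂P - 2 * ∫ ω, Y ω ^ 4 ∂P) := by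
    have j1 : Integrable (fun ω => (X + Y) ω ^ 4 + (X - Y) ω ^ 4) P := i1.add i2
    have j2 : Integrable (fun ω => (X + Y) ω ^ 4 + (X - Y) ω ^ 4 - 2 * X ω ^ 4) P :=
      j1.sub (i3.const_mul 2)
    rw [← integral_const_mul, ← integral_const_mul, ← integral_add i1 i2,
      ← integral_sub j1 (i3.const_mul 2), ← integral_sub j2 (i4.const_mul 2),
      ← integral_const_mul]
    congr 1; ext ω; simp only [Pi.add_apply, Pi.sub_apply]; ring
  rw [key, h1, h2, h3, h4, s1, s2]
  ring

lemma variance_sum_sq [IsProbabilityMeasure P] (hG : IsGaussianSpace P G) {ι : Type*}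
    (s : Finset ι) {X : ι → Ω → ℝ} (hX : ∀ i ∈ s, X i ∈ G) :
    Var[fun ω => ∑ i ∈ s, X i ω ^ 2; P] =
      2 * ∑ i ∈ s, ∑ j ∈ s, (∫ ω, X i ω * X j ω ∂P) ^ 2 := by
  have hL : MemLp (fun ω => ∑ i ∈ s, X i ω ^ 2) 2 P :=
    memLp_finsetSum s fun i hi => hG.memLp_sq (hX i hi)
  have hsq : ∀ i ∈ s, Integrable (fun ω => X i ω ^ 2) P := fun i hi => by
    simpa [pow_two] using hG.integrable_mul (hX i hi) (hX i hi)
  rw [variance_eq_sub hL]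
  have e1 : ((fun ω => ∑ i ∈ s, X i ω ^ 2) ^ 2 : Ω → ℝ) =
      fun ω => ∑ i ∈ s, ∑ j ∈ s, X i ω ^ 2 * X j ω ^ 2 := by
    ext ω; simp [pow_two, Finset.sum_mul_sum]
  rw [e1, integral_finsetSum _ fun i hi => integrable_finsetSum _ fun j hj =>
    hG.integrable_sq_mul_sq (hX i hi) (hX j hj), integral_finsetSum _ hsq, pow_two,
    Finset.sum_mul_sum, Finset.mul_sum, ← Finset.sum_sub_distrib]
  refine Finset.sum_congr rfl fun i hi => ?_
  rw [integral_finsetSum _ fun j hj => hG.integrable_sq_mul_sq (hX i hi) (hX j hj),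
    Finset.mul_sum, ← Finset.sum_sub_distrib]
  refine Finset.sum_congr rfl fun j hj => ?_
  rw [hG.integral_sq_mul_sq (hX i hi) (hX j hj)]
  ring

/-- Chebyshev's inequality: sums of squares in a Gaussian space concentrate around a
deterministic sequence `S` as soon as their means are equivalent to `κ S` and the sums of squared
covariances are negligible with respect to `S²`. -/
lemma tendstoInMeasure_sum_sq [IsProbabilityMeasure P] (hG : IsGaussianSpace P G) {ι : Type*}
    {s : ℕ → Finset ι} {X : ℕ → ι → Ω → ℝ} (hX : ∀ᶠ n in atTop, ∀ i ∈ s n, X n i ∈ G)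
    {S : ℕ → ℝ} {κ : ℝ} (hS : ∀ᶠ n in atTop, 0 < S n)
    (hmean : Tendsto (fun n => (∑ i ∈ s n, ∫ ω, X n i ω ^ 2 ∂P) / S n) atTop (𝓝 κ))
    (hcov : Tendsto (fun n => (∑ i ∈ s n, ∑ j ∈ s n, (∫ ω, X n i ω * X n j ω ∂P) ^ 2) / S n ^ 2)
      atTop (𝓝 0)) :
    TendstoInMeasure P (fun n ω => (∑ i ∈ s n, X n i ω ^ 2) / S n) atTop (fun _ => κ) := by
  rw [tendstoInMeasure_iff_norm]
  intro ε hε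
  have hlim : Tendsto (fun n => ENNReal.ofReal
      (2 * ((∑ i ∈ s n, ∑ j ∈ s n, (∫ ω, X n i ω * X n j ω ∂P) ^ 2) / S n ^ 2) / (ε / 2) ^ 2))
      atTop (𝓝 0) := by
    have := ENNReal.tendsto_ofReal ((hcov.const_mul 2).div_const ((ε / 2) ^ 2))
    simpa using this
  refine tendsto_of_tendsto_of_tendsto_of_le_of_le' tendsto_const_nhds hlim
    (Eventually.of_forall fun _ => zero_le) ?_
  have hm := (Metric.tendsto_nhds.1 hmean) (ε / 2) (by positivity)
  filter_upwards [hX, hS, hm] with n hXn hSn hmn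
  have hL : MemLp (fun ω => ∑ i ∈ s n, X n i ω ^ 2) 2 P :=
    memLp_finsetSum _ fun i hi => hG.memLp_sq (hXn i hi)
  have hsq : ∀ i ∈ s n, Integrable (fun ω => X n i ω ^ 2) P := fun i hi => by
    simpa [pow_two] using hG.integrable_mul (hXn i hi) (hXn i hi)
  have hcheb := meas_ge_le_variance_div_sq hL (c := S n * (ε / 2)) (by positivity)
  rw [hG.variance_sum_sq _ hXn, integral_finsetSum _ hsq] at hcheb
  refine (measure_mono ?_).trans (hcheb.trans (le_of_eq ?_))
  · intro ω hω
    simp only [mem_ofPred_eq, Real.norm_eq_abs, Real.dist_eq] at hω hmn ⊢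
    have htri : |(∑ i ∈ s n, X n i ω ^ 2) / S n - κ| ≤
        |(∑ i ∈ s n, X n i ω ^ 2) / S n - (∑ i ∈ s n, ∫ ω, X n i ω ^ 2 ∂P) / S n| +
        |(∑ i ∈ s n, ∫ ω, X n i ω ^ 2 ∂P) / S n - κ| := abs_sub_le _ _ _
    rw [← sub_div, abs_div, abs_of_pos hSn] at htri
    have h3 : ε / 2 ≤ |∑ i ∈ s n, X n i ω ^ 2 - ∑ i ∈ s n, ∫ ω, X n i ω ^ 2 ∂P| / S n := by
      linarith
    rw [le_div_iff₀ hSn] at h3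
    linarith
  · congr 1
    field_simp

end IsGaussianSpace

end GaussianSpace

/-! ### Closing a Gaussian space in `L²` -/

section L2Closure

variable {Ω : Type*} [MeasurableSpace Ω] {P : Measure Ω}

lemma tendsto_integral_mul_conj {α 𝕜 : Type*} [RCLike 𝕜] [MeasurableSpace α] {μ : Measure α}
    {f g : α → 𝕜} {F G : ℕ → α → 𝕜} (hf : MemLp f 2 μ) (hg : MemLp g 2 μ)
    (hF : ∀ k, MemLp (F k) 2 μ) (hG : ∀ k, MemLp (G k) 2 μ)
    (hFf : Tendsto (fun k => eLpNorm (fun a => F k a - f a) 2 μ) atTop (𝓝 0))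
    (hGg : Tendsto (fun k => eLpNorm (fun a => G k a - g a) 2 μ) atTop (𝓝 0)) :
    Tendsto (fun k => ∫ a, F k a * (starRingEnd 𝕜) (G k a) ∂μ) atTop
      (𝓝 (∫ a, f a * (starRingEnd 𝕜) (g a) ∂μ)) := by
  have key : ∀ {u v : α → 𝕜} (hu : MemLp u 2 μ) (hv : MemLp v 2 μ),
      inner 𝕜 (hv.toLp v) (hu.toLp u) = ∫ a, u a * (starRingEnd 𝕜) (v a) ∂μ := by
    intro u v hu hv
    rw [L2.inner_def]
    refine integral_congr_ae ?_
    filter_upwards [hu.coeFn_toLp, hv.coeFn_toLp] with a h1 h2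
    rw [h1, h2, RCLike.inner_apply]
  have h1 := (Lp.tendsto_Lp_iff_tendsto_eLpNorm'' F hF f hf).2 hFf
  have h2 := (Lp.tendsto_Lp_iff_tendsto_eLpNorm'' G hG g hg).2 hGg
  have h3 := h2.inner (𝕜 := 𝕜) h1
  simpa only [key] using h3

/-- The space of limits in `L²(P)` of square integrable elements of `G`. -/
def l2Closure (P : Measure Ω) (G : Submodule ℝ (Ω → ℝ)) : Submodule ℝ (Ω → ℝ) where
  carrier := {X | MemLp X 2 P ∧ ∃ Z : ℕ → Ω → ℝ, (∀ k, Z k ∈ G ∧ MemLp (Z k) 2 P) ∧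
    Tendsto (fun k => eLpNorm (fun ω => Z k ω - X ω) 2 P) atTop (𝓝 0)}
  zero_mem' := ⟨MemLp.zero, fun _ => 0, fun _ => ⟨G.zero_mem, MemLp.zero⟩, by simp⟩
  add_mem' := by
    rintro X Y ⟨hX, Z, hZ, hZX⟩ ⟨hY, Z', hZ', hZY⟩
    refine ⟨hX.add hY, fun k => Z k + Z' k,
      fun k => ⟨G.add_mem (hZ k).1 (hZ' k).1, (hZ k).2.add (hZ' k).2⟩, ?_⟩
    have hlim := hZX.add hZY
    rw [add_zero] at hlim
    refine tendsto_of_tendsto_of_tendsto_of_le_of_le tendsto_const_nhds hlim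
      (fun _ => zero_le) fun k => ?_
    have h := eLpNorm_add_le ((hZ k).2.sub hX).1 ((hZ' k).2.sub hY).1 (p := 2) (by simp)
    refine le_trans (le_of_eq (congrArg (fun f => eLpNorm f 2 P) ?_)) h
    ext ω
    simp only [Pi.add_apply, Pi.sub_apply]
    ring
  smul_mem' := by
    rintro c X ⟨hX, Z, hZ, hZX⟩
    refine ⟨hX.const_smul c, fun k => c • Z k,
      fun k => ⟨G.smul_mem c (hZ k).1, (hZ k).2.const_smul c⟩, ?_⟩
    have hlim := ENNReal.Tendsto.const_mul (a := ‖c‖ₑ) hZX (Or.inr (by simp))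
    rw [mul_zero] at hlim
    refine hlim.congr fun k => ?_
    rw [← eLpNorm_const_smul]
    congr 1
    ext ω
    simp [mul_sub]

lemma l2Closure_congr {G : Submodule ℝ (Ω → ℝ)} {X Y : Ω → ℝ} (hX : X ∈ l2Closure P G)
    (h : X =ᵐ[P] Y) : Y ∈ l2Closure P G := by
  obtain ⟨hX, Z, hZ, hZX⟩ := hX
  refine ⟨hX.ae_eq h, Z, hZ, hZX.congr fun k => eLpNorm_congr_ae ?_⟩
  filter_upwards [h] with ω hω
  rw [hω]

/-- Limits in `L²` of centred Gaussian variables are centred Gaussian: the variances converge,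
so the characteristic functions converge to that of a centred Gaussian law. -/
lemma IsGaussianSpace.l2Closure [IsProbabilityMeasure P] {G : Submodule ℝ (Ω → ℝ)}
    (hG : IsGaussianSpace P G) : IsGaussianSpace P (l2Closure P G) := by
  rintro X ⟨hX, Z, hZ, hZX⟩
  choose v hv using fun k => hG (Z k) (hZ k).1
  have hvZ : ∀ k, (v k : ℝ) = ∫ ω, Z k ω * (starRingEnd ℝ) (Z k ω) ∂P := by
    intro k
    have h1 := (hv k).variance_eq
    rw [variance_id_gaussianReal, variance_eq_integral (hv k).aemeasurable,
      (hv k).integral_eq] at h1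
    rw [← h1]
    simp [pow_two]
  have hlim : Tendsto (fun k => (v k : ℝ)) atTop (𝓝 (∫ ω, X ω * (starRingEnd ℝ) (X ω) ∂P)) := by
    simp only [hvZ]
    exact tendsto_integral_mul_conj hX hX (fun k => (hZ k).2) (fun k => (hZ k).2) hZX hZX
  set V := ∫ ω, X ω * (starRingEnd ℝ) (X ω) ∂P with hV
  have hV0 : 0 ≤ V := integral_nonneg fun ω => by simpa using mul_self_nonneg (X ω)
  have hmeas : TendstoInMeasure P Z atTop X :=
    tendstoInMeasure_of_tendsto_eLpNorm (p := 2) (by simp) (fun k => (hZ k).2.1) hX.1 hZX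
  have hdist := (hmeas.tendstoInDistribution fun k => (hv k).aemeasurable).tendsto
  have hchar := ProbabilityMeasure.tendsto_iff_tendsto_charFun.1 hdist
  refine ⟨V.toNNReal, hX.1.aemeasurable, ?_⟩
  have : IsProbabilityMeasure (P.map X) := Measure.isProbabilityMeasure_map hX.1.aemeasurable
  refine Measure.ext_of_charFun (funext fun t => ?_)
  refine tendsto_nhds_unique (hchar t) ?_
  simp only [ProbabilityMeasure.coe_mk, (hv _).map_eq, charFun_gaussianReal,
    Real.coe_toNNReal V hV0]
  have hc : Tendsto (fun k => ((v k : ℝ) : ℂ)) atTop (𝓝 (V : ℂ)) :=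
    (Complex.continuous_ofReal.tendsto V).comp hlim
  exact (Complex.continuous_exp.tendsto _).comp
    (tendsto_const_nhds.sub ((hc.mul_const _).div_const _))

end L2Closure

/-! ### The stochastic integral with respect to `W` -/

/-- The real vector space spanned by the variables `Re (z W(A))`, where `z` is a complex number
and `A` a Borel set of finite Lebesgue measure. -/
def elementarySpace {Ω : Type*} (W : Set ℝ → Ω → ℂ) : Submodule ℝ (Ω → ℝ) :=
  Submodule.span ℝ (range fun p : ℂ × {A : Set ℝ // MeasurableSet A ∧ volume A < ⊤} =>
    fun ω => (p.1 * W p.2.1 ω).re)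

lemma simpleFunc_eq_sum_indicator (φ : SimpleFunc ℝ ℂ) (u : ℝ) :
    φ u = ∑ z ∈ φ.range, (φ ⁻¹' {z}).indicator (fun _ => z) u := by
  rw [Finset.sum_eq_single (φ u)]
  · simp
  · intro z _ hz
    exact indicator_of_notMem (s := φ ⁻¹' {z}) (fun h => hz (mem_singleton_iff.1 h).symm) _
  · intro h
    exact absurd (SimpleFunc.mem_range_self φ u) h

lemma re_mul_simpleIntegral_mem {Ω : Type*} (W : Set ℝ → Ω → ℂ) (c : ℂ) {φ : SimpleFunc ℝ ℂ}
    (hφ : MemLp φ 2 volume) :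
    (fun ω => (c * simpleIntegral W φ ω).re) ∈ elementarySpace W := by
  have h : (fun ω => (c * simpleIntegral W φ ω).re) =
      ∑ z ∈ φ.range, fun ω => (c * z * W (φ ⁻¹' {z}) ω).re := by
    ext ω
    simp only [simpleIntegral, Finset.mul_sum, Complex.re_sum, Finset.sum_apply, mul_assoc]
  rw [h]
  refine Submodule.sum_mem _ fun z _ => ?_
  by_cases hz : z = 0
  · have : (fun ω => (c * z * W (φ ⁻¹' {z}) ω).re) = 0 := by ext ω; simp [hz]
    rw [this]
    exact Submodule.zero_mem _
  · exact Submodule.subset_span ⟨(c * z, ⟨φ ⁻¹' {z}, φ.measurableSet_fiber z,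
      φ.measure_preimage_lt_top_of_memLp (by simp) (by simp) hφ z hz⟩), rfl⟩

section StochIntegral

variable {Ω : Type*} [MeasurableSpace Ω] {P : Measure Ω} {W : Set ℝ → Ω → ℂ}

namespace IsComplexGaussianMeasure

lemma memLp_apply (hW : IsComplexGaussianMeasure P W) {A : Set ℝ} (hA : MeasurableSet A)
    (hA' : volume A < ⊤) : MemLp (W A) 2 P :=
  (hW.gaussian.hasGaussianLaw_eval ⟨A, hA, hA'⟩).memLp_two

lemma isGaussianSpace_elementarySpace (hW : IsComplexGaussianMeasure P W) :
    IsGaussianSpace P (elementarySpace W) := by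
  intro X hX
  obtain ⟨c, rfl⟩ := (Finsupp.mem_span_range_iff_exists_finsupp).1 hX
  let T := ℂ × {A : Set ℝ // MeasurableSet A ∧ volume A < ⊤}
  have hproc : IsGaussianProcess (fun (p : T) ω => c p • (p.1 * W p.2.1 ω).re) P :=
    ((hW.gaussian.comp_right (Prod.snd : T → _)).comp_left fun p : T =>
      Complex.reCLM.comp ((ContinuousLinearMap.mul ℝ ℂ) p.1)).smul c
  have hsum := hproc.hasGaussianLaw_fun_sum (I := c.support)
  have heq : (c.sum fun (i : T) a => a • fun ω => (i.1 * W i.2.1 ω).re) =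
      fun ω => ∑ p ∈ c.support, c p • (p.1 * W p.2.1 ω).re := by
    ext ω
    simp [Finsupp.sum]
  rw [heq]
  have hint : ∀ p : T, Integrable (fun ω => p.1 * W p.2.1 ω) P := fun p =>
    (hW.gaussian.hasGaussianLaw_eval p.2).integrable.const_mul p.1
  have hmean : ∫ ω, ∑ p ∈ c.support, c p • (p.1 * W p.2.1 ω).re ∂P = 0 := by
    have hre : ∀ p : T, Integrable (fun ω => c p • (p.1 * W p.2.1 ω).re) P := fun p =>
      ((hint p).re).smul (c p)
    rw [integral_finsetSum _ fun p _ => hre p]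
    refine Finset.sum_eq_zero fun p _ => ?_
    have h1 : ∫ ω, (p.1 * W p.2.1 ω).re ∂P = (∫ ω, p.1 * W p.2.1 ω ∂P).re := integral_re (hint p)
    rw [integral_smul, h1, integral_const_mul, hW.centred _ p.2.2.1 p.2.2.2]
    simp
  refine ⟨(Var[fun ω => ∑ p ∈ c.support, c p • (p.1 * W p.2.1 ω).re; P]).toNNReal,
    hsum.aemeasurable, ?_⟩
  rw [hsum.map_eq_gaussianReal, hmean]

lemma memLp_mul_apply_preimage (hW : IsComplexGaussianMeasure P W) {φ : SimpleFunc ℝ ℂ}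
    (hφ : MemLp φ 2 volume) (z : ℂ) : MemLp (fun ω => z * W (φ ⁻¹' {z}) ω) 2 P := by
  by_cases hz : z = 0
  · simp [hz]
  · exact (hW.memLp_apply (φ.measurableSet_fiber z)
      (φ.measure_preimage_lt_top_of_memLp (by simp) (by simp) hφ z hz)).const_mul z

lemma memLp_simpleIntegral (hW : IsComplexGaussianMeasure P W) {φ : SimpleFunc ℝ ℂ}
    (hφ : MemLp φ 2 volume) : MemLp (simpleIntegral W φ) 2 P :=
  memLp_finsetSum _ fun z _ => hW.memLp_mul_apply_preimage hφ z

lemma integral_simpleIntegral_mul_conj (hW : IsComplexGaussianMeasure P W)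
    {φ ψ : SimpleFunc ℝ ℂ} (hφ : MemLp φ 2 volume) (hψ : MemLp ψ 2 volume) :
    ∫ ω, simpleIntegral W φ ω * (starRingEnd ℂ) (simpleIntegral W ψ ω) ∂P =
      ∫ u, φ u * (starRingEnd ℂ) (ψ u) := by
  have hconj : ∀ {z : ℂ}, MemLp (fun ω => (starRingEnd ℂ) (z * W (ψ ⁻¹' {z}) ω)) 2 P :=
    (hW.memLp_mul_apply_preimage hψ _).star
  have hL : ∀ z w, Integrable (fun ω => z * W (φ ⁻¹' {z}) ω *
      (starRingEnd ℂ) (w * W (ψ ⁻¹' {w}) ω)) P := fun z w =>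
    (hW.memLp_mul_apply_preimage hφ z).integrable_mul hconj
  have hI : ∀ (χ : SimpleFunc ℝ ℂ), MemLp χ 2 volume → ∀ z,
      MemLp ((χ ⁻¹' {z}).indicator (fun _ : ℝ => z)) 2 volume := by
    intro χ hχ z
    by_cases hz : z = 0
    · simp [hz, indicator_zero]
    · exact memLp_indicator_const 2 (χ.measurableSet_fiber z) z
        (Or.inr (χ.measure_preimage_lt_top_of_memLp (by simp) (by simp) hχ z hz).ne)
  have hconjR : ∀ {z : ℂ}, MemLp (fun u => (starRingEnd ℂ)
      ((ψ ⁻¹' {z}).indicator (fun _ : ℝ => z) u)) 2 volume := (hI ψ hψ _).star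
  have hR : ∀ z w, Integrable (fun u => (φ ⁻¹' {z}).indicator (fun _ : ℝ => z) u *
      (starRingEnd ℂ) ((ψ ⁻¹' {w}).indicator (fun _ : ℝ => w) u)) volume := fun z w =>
    (hI φ hφ z).integrable_mul hconjR
  have e1 : ∀ ω, simpleIntegral W φ ω * (starRingEnd ℂ) (simpleIntegral W ψ ω) =
      ∑ z ∈ φ.range, ∑ w ∈ ψ.range, z * W (φ ⁻¹' {z}) ω *
        (starRingEnd ℂ) (w * W (ψ ⁻¹' {w}) ω) := by
    intro ω
    simp only [simpleIntegral, map_sum, Finset.sum_mul_sum]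
  have e2 : ∀ u, φ u * (starRingEnd ℂ) (ψ u) = ∑ z ∈ φ.range, ∑ w ∈ ψ.range,
      (φ ⁻¹' {z}).indicator (fun _ : ℝ => z) u *
        (starRingEnd ℂ) ((ψ ⁻¹' {w}).indicator (fun _ : ℝ => w) u) := by
    intro u
    conv_lhs => rw [simpleFunc_eq_sum_indicator φ u, simpleFunc_eq_sum_indicator ψ u]
    simp only [map_sum, Finset.sum_mul_sum]
  simp only [e1, e2]
  rw [integral_finsetSum _ fun z _ => integrable_finsetSum _ fun w _ => hL z w,
    integral_finsetSum _ fun z _ => integrable_finsetSum _ fun w _ => hR z w]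
  refine Finset.sum_congr rfl fun z _ => ?_
  rw [integral_finsetSum _ fun w _ => hL z w, integral_finsetSum _ fun w _ => hR z w]
  refine Finset.sum_congr rfl fun w _ => ?_
  by_cases hz : z = 0
  · simp [hz]
  by_cases hw : w = 0
  · simp [hw]
  have hA := φ.measure_preimage_lt_top_of_memLp (by simp) (by simp) hφ z hz
  have hB := ψ.measure_preimage_lt_top_of_memLp (by simp) (by simp) hψ w hw
  have i1 : ∀ ω, z * W (φ ⁻¹' {z}) ω * (starRingEnd ℂ) (w * W (ψ ⁻¹' {w}) ω) =
      z * (starRingEnd ℂ) w * (W (φ ⁻¹' {z}) ω * (starRingEnd ℂ) (W (ψ ⁻¹' {w}) ω)) := by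
    intro ω; rw [map_mul]; ring
  have i2 : ∀ u, (φ ⁻¹' {z}).indicator (fun _ : ℝ => z) u *
      (starRingEnd ℂ) ((ψ ⁻¹' {w}).indicator (fun _ : ℝ => w) u) =
      (φ ⁻¹' {z} ∩ ψ ⁻¹' {w}).indicator (fun _ : ℝ => z * (starRingEnd ℂ) w) u := by
    intro u
    by_cases h1 : u ∈ φ ⁻¹' {z} <;> by_cases h2 : u ∈ ψ ⁻¹' {w} <;>
      simp only [indicator, mem_inter_iff, h1, h2, if_true, if_false, and_self, and_true,
        and_false, map_zero, mul_zero, zero_mul]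
  simp only [i1, i2]
  rw [integral_const_mul, hW.covariance _ _ (φ.measurableSet_fiber z) hA
    (ψ.measurableSet_fiber w) hB, integral_indicator_const _
    ((φ.measurableSet_fiber z).inter (ψ.measurableSet_fiber w)), Complex.real_smul, mul_comm]

end IsComplexGaussianMeasure

namespace IsStochIntegral

variable {f g : ℝ → ℂ} {Y Z : Ω → ℂ}

/-- The isometry property `E[∫ f dW conj (∫ g dW)] = ∫ f conj g`. -/
lemma integral_mul_conj (hW : IsComplexGaussianMeasure P W) (hY : IsStochIntegral P W f Y)
    (hZ : IsStochIntegral P W g Z) :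
    ∫ ω, Y ω * (starRingEnd ℂ) (Z ω) ∂P = ∫ u, f u * (starRingEnd ℂ) (g u) := by
  obtain ⟨hf, hYL, φ, hφ, hφf, hφY⟩ := hY
  obtain ⟨hg, hZL, ψ, hψ, hψg, hψZ⟩ := hZ
  refine tendsto_nhds_unique (tendsto_integral_mul_conj hYL hZL
    (fun k => hW.memLp_simpleIntegral (hφ k)) (fun k => hW.memLp_simpleIntegral (hψ k)) hφY hψZ) ?_
  simp only [hW.integral_simpleIntegral_mul_conj (hφ _) (hψ _)]
  exact tendsto_integral_mul_conj hf hg hφ hψ hφf hψg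

lemma re_mul_mem_l2Closure (hW : IsComplexGaussianMeasure P W) (hY : IsStochIntegral P W f Y)
    (c : ℂ) : (fun ω => (c * Y ω).re) ∈ l2Closure P (elementarySpace W) := by
  obtain ⟨-, hYL, φ, hφ, -, hφY⟩ := hY
  refine ⟨(hYL.const_mul c).re, fun k ω => (c * simpleIntegral W (φ k) ω).re,
    fun k => ⟨re_mul_simpleIntegral_mem W c (hφ k),
      ((hW.memLp_simpleIntegral (hφ k)).const_mul c).re⟩, ?_⟩
  have hlim := ENNReal.Tendsto.const_mul (a := ENNReal.ofReal ‖c‖) hφY (Or.inr (by simp))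
  rw [mul_zero] at hlim
  refine tendsto_of_tendsto_of_tendsto_of_le_of_le tendsto_const_nhds hlim
    (fun _ => zero_le) fun k => ?_
  refine eLpNorm_le_mul_eLpNorm_of_ae_le_mul (Eventually.of_forall fun ω => ?_) 2
  rw [← Complex.sub_re, ← mul_sub, ← norm_mul]
  exact Complex.abs_re_le_norm _

end IsStochIntegral

end StochIntegral

/-! ### Power weights on the frequency axis -/

section Weights

lemma abs_exp_sub_exp_le {a b M : ℝ} (ha : Real.exp a ≤ M) (hb : Real.exp b ≤ M) :
    |Real.exp a - Real.exp b| ≤ |a - b| * M := by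
  have key : ∀ {a b : ℝ}, Real.exp a ≤ M → Real.exp a - Real.exp b ≤ |a - b| * M := by
    intro a b ha
    have h1 : b - a + 1 ≤ Real.exp (b - a) := Real.add_one_le_exp _
    have h2 : Real.exp b = Real.exp a * Real.exp (b - a) := by rw [← Real.exp_add]; ring_nf
    have h3 := Real.exp_pos a
    calc Real.exp a - Real.exp b ≤ (a - b) * Real.exp a := by rw [h2]; nlinarith
      _ ≤ |a - b| * Real.exp a := by gcongr; exact le_abs_self _
      _ ≤ |a - b| * M := by gcongr
  refine abs_sub_le_iff.2 ⟨key ha, ?_⟩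
  rw [abs_sub_comm]
  exact key hb

lemma rpow_neg_le_add {x s σ₁ σ₂ : ℝ} (hx : 0 < x) (h₁ : σ₁ ≤ s) (h₂ : s ≤ σ₂) :
    x ^ (-s) ≤ x ^ (-σ₁) + x ^ (-σ₂) := by
  rcases le_total 1 x with h | h
  · have := Real.rpow_le_rpow_of_exponent_le h (neg_le_neg h₁)
    have := Real.rpow_nonneg hx.le (-σ₂)
    linarith
  · have := Real.rpow_le_rpow_of_exponent_ge hx h (neg_le_neg h₂)
    have := Real.rpow_nonneg hx.le (-σ₁)
    linarith

/-- Powers of `x` depend on the exponent in a Lipschitz way, at the cost of an arbitrarily small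
loss in the exponent which absorbs the factor `log x`. -/
lemma abs_rpow_neg_sub_rpow_neg_le {x s s' σ₁ σ₂ δ₁ δ₂ : ℝ} (hx : 0 < x)
    (hs : s ∈ Icc σ₁ σ₂) (hs' : s' ∈ Icc σ₁ σ₂) (hδ₁ : 0 < δ₁) (hδ₂ : 0 < δ₂) :
    |x ^ (-s) - x ^ (-s')| ≤
      |s - s'| * ((1 / δ₁ + 1 / δ₂) * (x ^ (-(σ₁ - δ₁)) + x ^ (-(σ₂ + δ₂)))) := by
  have hA := Real.rpow_pos_of_pos hx (-(σ₁ - δ₁))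
  have hB := Real.rpow_pos_of_pos hx (-(σ₂ + δ₂))
  have e : ∀ r : ℝ, x ^ (-r) = Real.exp (-r * Real.log x) := fun r => by
    rw [Real.rpow_def_of_pos hx]; ring_nf
  have habs : |-s * Real.log x - -s' * Real.log x| = |s - s'| * |Real.log x| := by
    rw [← abs_mul, ← abs_neg]; congr 1; ring
  have h1 : 0 < 1 / δ₁ := by positivity
  have h2 : 0 < 1 / δ₂ := by positivity
  rcases le_total 1 x with h | h
  · have hM : ∀ r ∈ Icc σ₁ σ₂, Real.exp (-r * Real.log x) ≤ x ^ (-σ₁) := fun r hr => by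
      rw [← e]; exact Real.rpow_le_rpow_of_exponent_le h (neg_le_neg hr.1)
    have hlog : |Real.log x| ≤ x ^ δ₁ / δ₁ := by
      rw [abs_of_nonneg (Real.log_nonneg h)]
      exact Real.log_le_rpow_div hx.le hδ₁
    rw [e, e]
    refine (abs_exp_sub_exp_le (hM s hs) (hM s' hs')).trans ?_
    rw [habs, mul_assoc]
    refine mul_le_mul_of_nonneg_left ?_ (abs_nonneg _)
    calc |Real.log x| * x ^ (-σ₁) ≤ x ^ δ₁ / δ₁ * x ^ (-σ₁) := by gcongr
      _ = 1 / δ₁ * x ^ (-(σ₁ - δ₁)) := by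
        rw [show -(σ₁ - δ₁) = δ₁ + -σ₁ by ring, Real.rpow_add hx]; ring
      _ ≤ _ := by nlinarith [mul_pos h1 hB, mul_pos h2 hA, mul_pos h2 hB]
  · have hM : ∀ r ∈ Icc σ₁ σ₂, Real.exp (-r * Real.log x) ≤ x ^ (-σ₂) := fun r hr => by
      rw [← e]; exact Real.rpow_le_rpow_of_exponent_ge hx h (neg_le_neg hr.2)
    have hlog : |Real.log x| ≤ x ^ (-δ₂) / δ₂ := by
      rw [abs_of_nonpos (Real.log_nonpos hx.le h), ← Real.log_inv, Real.rpow_neg hx.le,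
        ← Real.inv_rpow hx.le]
      exact Real.log_le_rpow_div (inv_nonneg.2 hx.le) hδ₂
    rw [e, e]
    refine (abs_exp_sub_exp_le (hM s hs) (hM s' hs')).trans ?_
    rw [habs, mul_assoc]
    refine mul_le_mul_of_nonneg_left ?_ (abs_nonneg _)
    calc |Real.log x| * x ^ (-σ₂) ≤ x ^ (-δ₂) / δ₂ * x ^ (-σ₂) := by gcongr
      _ = 1 / δ₂ * x ^ (-(σ₂ + δ₂)) := by
        rw [show -(σ₂ + δ₂) = -δ₂ + -σ₂ by ring, Real.rpow_add hx]; ring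
      _ ≤ _ := by nlinarith [mul_pos h1 hB, mul_pos h1 hA, mul_pos h2 hA]

lemma integrable_min_sq_mul_rpow {p : ℝ} (hp1 : 1 < p) (hp3 : p < 3) :
    Integrable (fun u : ℝ => min 2 |u| ^ 2 * |u| ^ (-p)) := by
  have hmeas : Measurable (fun u : ℝ => min 2 |u| ^ 2 * |u| ^ (-p)) := by fun_prop
  have hIoi : IntegrableOn (fun u : ℝ => min 2 |u| ^ 2 * |u| ^ (-p)) (Ioi 0) := by
    rw [← Ioc_union_Ioi_eq_Ioi (zero_le_one' ℝ)]
    refine IntegrableOn.union ?_ ?_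
    · have h1 : IntegrableOn (fun u : ℝ => u ^ (2 - p)) (Ioc 0 1) :=
        (intervalIntegrable_iff_integrableOn_Ioc_of_le zero_le_one).1
          (intervalIntegral.intervalIntegrable_rpow' (by linarith))
      refine Integrable.mono' h1 hmeas.aestronglyMeasurable ?_
      refine (ae_restrict_iff' measurableSet_Ioc).2 (Eventually.of_forall fun u hu => ?_)
      have hu0 : 0 < u := hu.1
      rw [Real.norm_of_nonneg (by positivity), abs_of_pos hu0, sub_eq_add_neg,
        Real.rpow_add hu0, Real.rpow_two]
      gcongr
      exact min_le_right _ _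
    · have h1 : IntegrableOn (fun u : ℝ => 4 * u ^ (-p)) (Ioi 1) :=
        (integrableOn_Ioi_rpow_of_lt (by linarith) one_pos).const_mul 4
      refine Integrable.mono' h1 hmeas.aestronglyMeasurable ?_
      refine (ae_restrict_iff' measurableSet_Ioi).2 (Eventually.of_forall fun u hu => ?_)
      have hu0 : 0 < u := one_pos.trans hu
      rw [Real.norm_of_nonneg (by positivity), abs_of_pos hu0]
      gcongr
      have : min 2 u ≤ 2 := min_le_left _ _
      have : 0 ≤ min 2 u := le_min zero_le_two hu0.le
      nlinarith
  have hIio : IntegrableOn (fun u : ℝ => min 2 |u| ^ 2 * |u| ^ (-p)) (Iio 0) := by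
    have := (Measure.measurePreserving_neg (volume : Measure ℝ)).integrableOn_comp_preimage
      (Homeomorph.neg ℝ).measurableEmbedding (f := fun u : ℝ => min 2 |u| ^ 2 * |u| ^ (-p))
      (s := Ioi 0)
    rw [← this] at hIoi
    simpa [Function.comp_def] using hIoi
  have h := hIio.union ((integrableOn_Ici_iff_integrableOn_Ioi).2 hIoi)
  rwa [Iio_union_Ici, integrableOn_univ] at h

/-- An integrable weight which dominates the spectral densities
`‖exp (i y) - 1‖² / |y| ^ (2 H + 1)` together with their difference quotients in `H`, for all
`H ∈ [α, β] ⊆ (0, 1)`. The exponents `α + 1 > 1` and `β + 2 < 3` leave room on both sides of the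
exponents `2 H + 1 ∈ [2 α + 1, 2 β + 1]`, to absorb the logarithm coming from differentiation in
`H`. -/
noncomputable def domWeight (α β u : ℝ) : ℝ :=
  min 2 |u| ^ 2 * (|u| ^ (-(α + 1)) + |u| ^ (-(β + 2)))

lemma domWeight_nonneg (α β u : ℝ) : 0 ≤ domWeight α β u := by
  unfold domWeight; positivity

lemma integrable_domWeight {α β : ℝ} (hα : 0 < α) (hαβ : α ≤ β) (hβ : β < 1) :
    Integrable (domWeight α β) := by
  have h1 := integrable_min_sq_mul_rpow (p := α + 1) (by linarith) (by linarith)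
  have h2 := integrable_min_sq_mul_rpow (p := β + 2) (by linarith) (by linarith)
  convert! h1.add h2 using 1
  ext u
  simp only [domWeight, Pi.add_apply]
  ring

lemma norm_exp_sub_one_le {k : ℝ} (hk : 0 ≤ k) (u : ℝ) :
    ‖Complex.exp (Complex.I * (k : ℂ) * (u : ℂ)) - 1‖ ≤ max 1 k * min 2 |u| := by
  have e : Complex.I * (k : ℂ) * (u : ℂ) = Complex.I * ((k * u : ℝ) : ℂ) := by
    push_cast; ring
  rw [e, mul_min_of_nonneg _ _ (by positivity)]
  refine le_min ?_ ?_
  · have h1 : ‖Complex.exp (Complex.I * ((k * u : ℝ) : ℂ)) - 1‖ ≤ 1 + 1 := by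
      refine (norm_sub_le _ _).trans ?_
      rw [mul_comm Complex.I, Complex.norm_exp_ofReal_mul_I, norm_one]
    have := le_max_left 1 k
    linarith
  · refine Real.norm_exp_I_mul_ofReal_sub_one_le.trans ?_
    rw [norm_mul, Real.norm_of_nonneg hk, Real.norm_eq_abs]
    gcongr
    exact le_max_right _ _

end Weights

/-! ### Spectral covariances of fractional increments -/

section SpectralCov

/-- The spectral density `‖exp (i k y) - 1‖² / |y| ^ (2 H + 1)` of the increments of lag `k` of a
fractional Brownian motion with Hurst index `H`. -/
noncomputable def spectralDensity (k H y : ℝ) : ℝ :=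
  ‖Complex.exp (Complex.I * (k : ℂ) * (y : ℂ)) - 1‖ ^ 2 * |y| ^ (-(2 * H + 1))

/-- The (unnormalised) covariance of two increments of lag `k`, at distance `m` from each other,
of a fractional Brownian motion with Hurst index `H`. -/
noncomputable def spectralCov (k m H : ℝ) : ℂ :=
  ∫ y : ℝ, Complex.exp (Complex.I * (m : ℂ) * (y : ℂ)) * (spectralDensity k H y : ℂ)

lemma spectralDensity_nonneg (k H y : ℝ) : 0 ≤ spectralDensity k H y := by
  unfold spectralDensity; positivity

lemma measurable_spectralDensity (k H : ℝ) : Measurable (spectralDensity k H) := by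
  unfold spectralDensity; fun_prop

lemma norm_exp_I_mul_mul (m y : ℝ) : ‖Complex.exp (Complex.I * (m : ℂ) * (y : ℂ))‖ = 1 := by
  have e : Complex.I * (m : ℂ) * (y : ℂ) = ((m * y : ℝ) : ℂ) * Complex.I := by push_cast; ring
  rw [e, Complex.norm_exp_ofReal_mul_I]

variable {α β k H H' : ℝ}

lemma sq_norm_exp_sub_one_le (hk : 0 ≤ k) (y : ℝ) :
    ‖Complex.exp (Complex.I * (k : ℂ) * (y : ℂ)) - 1‖ ^ 2 ≤ max 1 k ^ 2 * min 2 |y| ^ 2 := by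
  rw [← mul_pow]
  gcongr
  exact norm_exp_sub_one_le hk y

lemma spectralDensity_le (hα : 0 < α) (hβ : β < 1) (hH : H ∈ Icc α β) (hk : 0 ≤ k) (y : ℝ) :
    spectralDensity k H y ≤ max 1 k ^ 2 * domWeight α β y := by
  rcases eq_or_ne y 0 with rfl | hy
  · have : spectralDensity k H 0 = 0 := by simp [spectralDensity]
    rw [this]
    have := domWeight_nonneg α β 0
    positivity
  · unfold spectralDensity domWeight
    rw [← mul_assoc]
    gcongr
    · exact sq_norm_exp_sub_one_le hk y
    · exact rpow_neg_le_add (abs_pos.2 hy) (by linarith [hH.1]) (by linarith [hH.2])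

lemma integrable_spectralDensity (hH : H ∈ Ioo (0 : ℝ) 1) (hk : 0 ≤ k) :
    Integrable (spectralDensity k H) := by
  refine Integrable.mono' ((integrable_domWeight hH.1 le_rfl hH.2).const_mul (max 1 k ^ 2))
    (measurable_spectralDensity k H).aestronglyMeasurable (Eventually.of_forall fun y => ?_)
  rw [Real.norm_of_nonneg (spectralDensity_nonneg _ _ _)]
  exact spectralDensity_le hH.1 hH.2 ⟨le_rfl, le_rfl⟩ hk y

lemma integrable_exp_mul_spectralDensity (hH : H ∈ Ioo (0 : ℝ) 1) (hk : 0 ≤ k) (m : ℝ) :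
    Integrable fun y : ℝ =>
      Complex.exp (Complex.I * (m : ℂ) * (y : ℂ)) * (spectralDensity k H y : ℂ) := by
  refine Integrable.mono' (integrable_spectralDensity hH hk) ?_ (Eventually.of_forall fun y => ?_)
  · have := measurable_spectralDensity k H
    exact Measurable.aestronglyMeasurable (by fun_prop)
  · rw [norm_mul, norm_exp_I_mul_mul, one_mul, Complex.norm_real,
      Real.norm_of_nonneg (spectralDensity_nonneg _ _ _)]

lemma norm_spectralCov_le (hα : 0 < α) (hβ : β < 1) (hH : H ∈ Icc α β) (hk : 0 ≤ k) (m : ℝ) :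
    ‖spectralCov k m H‖ ≤ max 1 k ^ 2 * ∫ y, domWeight α β y := by
  rw [← integral_const_mul]
  refine norm_integral_le_of_norm_le
    ((integrable_domWeight hα (hH.1.trans hH.2) hβ).const_mul _) (Eventually.of_forall fun y => ?_)
  rw [norm_mul, norm_exp_I_mul_mul, one_mul, Complex.norm_real,
    Real.norm_of_nonneg (spectralDensity_nonneg _ _ _)]
  exact spectralDensity_le hα hβ hH hk y

lemma spectralCov_zero (k H : ℝ) : spectralCov k 0 H = ((∫ y, spectralDensity k H y : ℝ) : ℂ) := by
  rw [spectralCov, ← integral_complex_ofReal]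
  simp

lemma exists_norm_spectralCov_sub_le (hα : 0 < α) (hβ : β < 1) (hk : 0 ≤ k) :
    ∃ C : ℝ, 0 ≤ C ∧ ∀ H ∈ Icc α β, ∀ H' ∈ Icc α β, ∀ m : ℝ,
      ‖spectralCov k m H - spectralCov k m H'‖ ≤ C * |H - H'| := by
  set c : ℝ := max 1 k ^ 2 * (2 * (1 / α + 1 / (1 - β))) with hc
  have hβ' : 0 < 1 - β := by linarith
  have hc0 : 0 ≤ c := by positivity
  refine ⟨c * ∫ y, domWeight α β y, mul_nonneg hc0 (integral_nonneg (domWeight_nonneg α β)),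
    fun H hH H' hH' m => ?_⟩
  have hI : H ∈ Ioo (0 : ℝ) 1 := ⟨hα.trans_le hH.1, hH.2.trans_lt hβ⟩
  have hI' : H' ∈ Ioo (0 : ℝ) 1 := ⟨hα.trans_le hH'.1, hH'.2.trans_lt hβ⟩
  rw [spectralCov, spectralCov, ← integral_sub (integrable_exp_mul_spectralDensity hI hk m)
    (integrable_exp_mul_spectralDensity hI' hk m), mul_right_comm, ← integral_const_mul]
  refine norm_integral_le_of_norm_le ((integrable_domWeight hα (hH.1.trans hH.2) hβ).const_mul _)
    (Eventually.of_forall fun y => ?_)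
  rw [← mul_sub, norm_mul, norm_exp_I_mul_mul, one_mul, ← Complex.ofReal_sub, Complex.norm_real,
    Real.norm_eq_abs]
  rcases eq_or_ne y 0 with rfl | hy
  · have h0 : ∀ H, spectralDensity k H 0 = 0 := fun H => by simp [spectralDensity]
    rw [h0, h0, sub_zero, abs_zero]
    exact mul_nonneg (mul_nonneg hc0 (abs_nonneg _)) (domWeight_nonneg _ _ _)
  · have h1 := abs_rpow_neg_sub_rpow_neg_le (abs_pos.2 hy) (s := 2 * H + 1) (s' := 2 * H' + 1)
      (σ₁ := 2 * α + 1) (σ₂ := 2 * β + 1) ⟨by linarith [hH.1], by linarith [hH.2]⟩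
      ⟨by linarith [hH'.1], by linarith [hH'.2]⟩ hα hβ'
    rw [show -(2 * α + 1 - α) = -(α + 1) by ring, show -(2 * β + 1 + (1 - β)) = -(β + 2) by ring,
      show 2 * H + 1 - (2 * H' + 1) = 2 * (H - H') by ring, abs_mul, abs_two] at h1
    unfold spectralDensity domWeight
    rw [← mul_sub, abs_mul, abs_of_nonneg (by positivity)]
    calc _ ≤ max 1 k ^ 2 * min 2 |y| ^ 2 * (2 * |H - H'| * ((1 / α + 1 / (1 - β)) *
          (|y| ^ (-(α + 1)) + |y| ^ (-(β + 2))))) :=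
          mul_le_mul (sq_norm_exp_sub_one_le hk y) h1 (abs_nonneg _) (by positivity)
      _ = _ := by rw [hc]; ring

lemma tendsto_spectralCov_cocompact (k H : ℝ) :
    Tendsto (fun m => spectralCov k m H) (cocompact ℝ) (𝓝 0) := by
  have h := Real.tendsto_integral_exp_smul_cocompact (fun y => (spectralDensity k H y : ℂ))
  have hlin : Tendsto (fun m : ℝ => m * (-(2 * Real.pi))⁻¹) (cocompact ℝ) (cocompact ℝ) :=
    (Homeomorph.mulRight₀ (-(2 * Real.pi))⁻¹
      (inv_ne_zero (neg_ne_zero.2 Real.two_pi_pos.ne'))).isClosedEmbedding.tendsto_cocompact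
  refine (h.comp hlin).congr fun m => ?_
  simp only [Function.comp_apply, spectralCov]
  congr 1
  ext y
  rw [Circle.smul_def, Real.fourierChar_apply, smul_eq_mul]
  congr 2
  have : (Real.pi : ℂ) ≠ 0 := Complex.ofReal_ne_zero.2 Real.pi_ne_zero
  push_cast
  field_simp

/-- The Riemann-Lebesgue lemma for the spectral covariances, uniformly in the Hurst index: by the
Lipschitz dependence on the index it is enough to have it on a finite net. -/
lemma eventually_norm_spectralCov_le (hα : 0 < α) (hβ : β < 1) (hk : 0 ≤ k) {ε : ℝ} (hε : 0 < ε) :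
    ∀ᶠ m in cocompact ℝ, ∀ H ∈ Icc α β, ‖spectralCov k m H‖ ≤ ε := by
  obtain ⟨C, hC0, hC⟩ := exists_norm_spectralCov_sub_le (k := k) hα hβ hk
  have hδ : 0 < ε / (2 * (C + 1)) := by positivity
  obtain ⟨t, htI, htf, htc⟩ := finite_cover_balls_of_compact (isCompact_Icc (a := α) (b := β)) hδ
  have h : ∀ᶠ m in cocompact ℝ, ∀ H ∈ t, ‖spectralCov k m H‖ < ε / 2 :=
    (eventually_all_finite htf).2 fun H _ =>
      (tendsto_spectralCov_cocompact k H).norm.eventually_lt_const (by simpa using half_pos hε)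
  filter_upwards [h] with m hm H hH
  obtain ⟨H', hH't, hHH'⟩ := mem_iUnion₂.1 (htc hH)
  rw [Metric.mem_ball, Real.dist_eq] at hHH'
  have h1 := hC H hH H' (htI hH't) m
  have h2 := hm H' hH't
  have h3 : C * |H - H'| ≤ ε / 2 := by
    calc C * |H - H'| ≤ (C + 1) * (ε / (2 * (C + 1))) := by gcongr; linarith
      _ = ε / 2 := by field_simp
  have h4 := norm_le_norm_add_norm_sub' (spectralCov k m H) (spectralCov k m H')
  linarith

/-- Self-similarity of fractional Brownian motion. -/
lemma spectralCov_mul_left {c : ℝ} (hc : 0 < c) (k m H : ℝ) :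
    spectralCov (c * k) (c * m) H = (c ^ (2 * H) : ℝ) * spectralCov k m H := by
  have h := Measure.integral_comp_mul_left (fun y : ℝ =>
    Complex.exp (Complex.I * (m : ℂ) * (y : ℂ)) * (spectralDensity k H y : ℂ)) c
  have hpt : ∀ y : ℝ, Complex.exp (Complex.I * ((c * m : ℝ) : ℂ) * (y : ℂ)) *
      (spectralDensity (c * k) H y : ℂ) = ((c ^ (2 * H + 1) : ℝ) : ℂ) *
        (Complex.exp (Complex.I * (m : ℂ) * ((c * y : ℝ) : ℂ)) *
          (spectralDensity k H (c * y) : ℂ)) := by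
    intro y
    have e1 : |y| ^ (-(2 * H + 1)) = c ^ (2 * H + 1) * |c * y| ^ (-(2 * H + 1)) := by
      rw [abs_mul, abs_of_pos hc, Real.mul_rpow hc.le (abs_nonneg _), Real.rpow_neg hc.le,
        mul_inv_cancel_left₀ (Real.rpow_pos_of_pos hc _).ne']
    have e2 : Complex.I * ((c * k : ℝ) : ℂ) * (y : ℂ) =
        Complex.I * (k : ℂ) * ((c * y : ℝ) : ℂ) := by push_cast; ring
    have e3 : Complex.I * ((c * m : ℝ) : ℂ) * (y : ℂ) =
        Complex.I * (m : ℂ) * ((c * y : ℝ) : ℂ) := by push_cast; ring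
    simp only [spectralDensity]
    rw [e1, e2, e3]
    push_cast
    ring
  rw [spectralCov]
  simp only [hpt]
  rw [integral_const_mul, h, abs_of_pos (inv_pos.2 hc), Complex.real_smul, ← mul_assoc,
    ← Complex.ofReal_mul, Real.rpow_add hc, Real.rpow_one, mul_assoc, mul_inv_cancel₀ hc.ne',
    mul_one]
  rfl

/-- The variance of a fractional increment is positive. Its exact value `normConst H ^ 2` is not
needed, since it cancels in the ratio statistic. -/
lemma spectralCov_one_zero_pos (hH : H ∈ Ioo (0 : ℝ) 1) : 0 < (spectralCov 1 0 H).re := by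
  rw [spectralCov_zero, Complex.ofReal_re, integral_pos_iff_support_of_nonneg
    (fun y => spectralDensity_nonneg 1 H y) (integrable_spectralDensity hH zero_le_one)]
  have hsub : Ioo 0 Real.pi ⊆ Function.support (spectralDensity 1 H) := by
    intro y hy
    have h1 : Complex.exp (Complex.I * ((1 : ℝ) : ℂ) * (y : ℂ)) ≠ 1 := by
      intro h
      have h2 : Complex.exp (Complex.I * ((1 : ℝ) : ℂ) * (y : ℂ)) =
          Complex.exp ((y : ℂ) * Complex.I) := by congr 1; push_cast; ring
      rw [h2, Complex.exp_mul_I] at h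
      have h3 := congrArg Complex.im h
      rw [← Complex.ofReal_cos, ← Complex.ofReal_sin] at h3
      simp at h3
      exact (Real.sin_pos_of_mem_Ioo hy).ne' h3
    have h4 : 0 < ‖Complex.exp (Complex.I * ((1 : ℝ) : ℂ) * (y : ℂ)) - 1‖ :=
      norm_pos_iff.2 (sub_ne_zero.2 h1)
    have h5 : 0 < |y| ^ (-(2 * H + 1)) := Real.rpow_pos_of_pos (abs_pos.2 hy.1.ne') _
    exact (mul_pos (pow_pos h4 2) h5).ne'
  refine lt_of_lt_of_le ?_ (measure_mono hsub)
  simp [Real.pi_pos]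

end SpectralCov

/-! ### The harmonizable kernel as an element of `L²` -/

section Kernel

variable {α β H H' t s δ : ℝ}

lemma measurable_harmonizableKernel (t H : ℝ) : Measurable (harmonizableKernel t H) := by
  unfold harmonizableKernel; fun_prop

lemma norm_harmonizableKernel (t H u : ℝ) : ‖harmonizableKernel t H u‖ =
    ‖Complex.exp (Complex.I * (t : ℂ) * (u : ℂ)) - 1‖ * |u| ^ (-(H + 1 / 2)) := by
  rw [harmonizableKernel, norm_div, Complex.norm_real, Real.norm_of_nonneg (by positivity),
    Real.rpow_neg (abs_nonneg u), div_eq_mul_inv]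

lemma sq_norm_harmonizableKernel (t H u : ℝ) :
    ‖harmonizableKernel t H u‖ ^ 2 = spectralDensity t H u := by
  rw [norm_harmonizableKernel, mul_pow, spectralDensity, ← Real.rpow_mul_natCast (abs_nonneg u)]
  congr 2
  push_cast
  ring

lemma memLp_harmonizableKernel (hH : H ∈ Ioo (0 : ℝ) 1) (ht : 0 ≤ t) :
    MemLp (harmonizableKernel t H) 2 volume := by
  rw [memLp_two_iff_integrable_sq_norm (measurable_harmonizableKernel t H).aestronglyMeasurable]
  simp only [sq_norm_harmonizableKernel]
  exact integrable_spectralDensity hH ht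

lemma harmonizableKernel_add_sub (t δ H u : ℝ) :
    harmonizableKernel (t + δ) H u - harmonizableKernel t H u =
      Complex.exp (Complex.I * (t : ℂ) * (u : ℂ)) *
        ((Complex.exp (Complex.I * (δ : ℂ) * (u : ℂ)) - 1) / ((|u| ^ (H + 1 / 2) : ℝ) : ℂ)) := by
  have e : Complex.exp (Complex.I * ((t + δ : ℝ) : ℂ) * (u : ℂ)) =
      Complex.exp (Complex.I * (t : ℂ) * (u : ℂ)) *
        Complex.exp (Complex.I * (δ : ℂ) * (u : ℂ)) := by
    rw [← Complex.exp_add]; congr 1; push_cast; ring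
  rw [harmonizableKernel, harmonizableKernel, e]
  ring

lemma increment_mul_conj (t s δ H H' u : ℝ) :
    (harmonizableKernel (t + δ) H u - harmonizableKernel t H u) *
      (starRingEnd ℂ) (harmonizableKernel (s + δ) H' u - harmonizableKernel s H' u) =
      Complex.exp (Complex.I * ((t - s : ℝ) : ℂ) * (u : ℂ)) *
        (spectralDensity δ ((H + H') / 2) u : ℂ) := by
  rw [harmonizableKernel_add_sub, harmonizableKernel_add_sub]
  set z := Complex.exp (Complex.I * (δ : ℂ) * (u : ℂ)) - 1 with hz
  -- at `u = 0` both sides vanish, whatever the value of the powers of `|u|`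
  rcases eq_or_ne u 0 with rfl | hu
  · have : z = 0 := by simp [hz]
    simp [this, spectralDensity]
  · have hu' := abs_pos.2 hu
    have e1 : (starRingEnd ℂ) (Complex.exp (Complex.I * (s : ℂ) * (u : ℂ))) =
        Complex.exp (-(Complex.I * (s : ℂ) * (u : ℂ))) := by
      rw [← Complex.exp_conj]; congr 1; simp
    have e2 : Complex.exp (Complex.I * ((t - s : ℝ) : ℂ) * (u : ℂ)) =
        Complex.exp (Complex.I * (t : ℂ) * (u : ℂ)) *
          Complex.exp (-(Complex.I * (s : ℂ) * (u : ℂ))) := by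
      rw [← Complex.exp_add]; congr 1; push_cast; ring
    have e3 : |u| ^ (-(2 * ((H + H') / 2) + 1)) = (|u| ^ (H + 1 / 2))⁻¹ * (|u| ^ (H' + 1 / 2))⁻¹ := by
      rw [← Real.rpow_neg hu'.le, ← Real.rpow_neg hu'.le, ← Real.rpow_add hu']
      congr 1; ring
    rw [spectralDensity, map_mul, map_div₀, e1, Complex.conj_ofReal, e2, e3, ← hz]
    push_cast
    rw [← Complex.mul_conj' z]
    ring

/-- For a time `t ∈ [0, 1]` the kernel is Lipschitz in the Hurst index, in `L²`. -/
lemma sq_norm_harmonizableKernel_sub_le (ht : t ∈ Icc (0 : ℝ) 1) (hα : 0 < α) (hβ : β < 1)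
    (hH : H ∈ Icc α β) (hH' : H' ∈ Icc α β) (u : ℝ) :
    ‖harmonizableKernel t H u - harmonizableKernel t H' u‖ ^ 2 ≤
      (|H - H'| * (1 / (α / 2) + 1 / ((1 - β) / 2))) ^ 2 * 2 * domWeight α β u := by
  rcases eq_or_ne u 0 with rfl | hu
  · have h0 : ∀ H, harmonizableKernel t H 0 = 0 := fun H => by simp [harmonizableKernel]
    rw [h0, h0]
    have := domWeight_nonneg α β 0
    rw [sub_zero, norm_zero, zero_pow two_ne_zero]
    exact mul_nonneg (mul_nonneg (sq_nonneg _) zero_le_two) this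
  · have hu' := abs_pos.2 hu
    have hk := norm_exp_sub_one_le ht.1 u
    rw [max_eq_left ht.2, one_mul] at hk
    have h1 := abs_rpow_neg_sub_rpow_neg_le hu' (s := H + 1 / 2) (s' := H' + 1 / 2)
      (σ₁ := α + 1 / 2) (σ₂ := β + 1 / 2) ⟨by linarith [hH.1], by linarith [hH.2]⟩
      ⟨by linarith [hH'.1], by linarith [hH'.2]⟩ (half_pos hα)
      (half_pos (sub_pos.2 hβ))
    rw [show H + 1 / 2 - (H' + 1 / 2) = H - H' by ring] at h1
    set c := 1 / (α / 2) + 1 / ((1 - β) / 2) with hc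
    set A := |u| ^ (-(α + 1 / 2 - α / 2)) with hA
    set B := |u| ^ (-(β + 1 / 2 + (1 - β) / 2)) with hB
    have eA : A ^ 2 = |u| ^ (-(α + 1)) := by
      rw [hA, ← Real.rpow_mul_natCast hu'.le]; congr 1; push_cast; ring
    have eB : B ^ 2 = |u| ^ (-(β + 2)) := by
      rw [hB, ← Real.rpow_mul_natCast hu'.le]; congr 1; push_cast; ring
    have e : ‖harmonizableKernel t H u - harmonizableKernel t H' u‖ =
        ‖Complex.exp (Complex.I * (t : ℂ) * (u : ℂ)) - 1‖ *
          |(|u| ^ (-(H + 1 / 2)) - |u| ^ (-(H' + 1 / 2)))| := by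
      rw [← Real.norm_eq_abs, ← Complex.norm_real, ← norm_mul]
      congr 1
      rw [harmonizableKernel, harmonizableKernel, Real.rpow_neg hu'.le, Real.rpow_neg hu'.le]
      push_cast
      ring
    rw [e]
    have hmin : 0 ≤ min 2 |u| := by positivity
    calc _ ≤ (min 2 |u| * (|H - H'| * (c * (A + B)))) ^ 2 := by gcongr
      _ = (|H - H'| * c) ^ 2 * (min 2 |u| ^ 2 * (A + B) ^ 2) := by ring
      _ ≤ (|H - H'| * c) ^ 2 * (min 2 |u| ^ 2 * (2 * (A ^ 2 + B ^ 2))) := by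
        gcongr
        nlinarith [sq_nonneg (A - B)]
      _ = _ := by rw [eA, eB, domWeight]; ring

open Classical in
/-- The class in `L²(ℝ; ℂ)` of the kernel `harmonizableKernel t H` (zero when the kernel is not
square integrable, which does not happen for `0 ≤ t` and `0 < H < 1`). -/
noncomputable def kernelL2 (t H : ℝ) : Lp ℂ 2 (volume : Measure ℝ) :=
  if hK : MemLp (harmonizableKernel t H) 2 volume then hK.toLp _ else 0

lemma coeFn_kernelL2 (hH : H ∈ Ioo (0 : ℝ) 1) (ht : 0 ≤ t) :
    kernelL2 t H =ᵐ[volume] harmonizableKernel t H := by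
  rw [kernelL2, dif_pos (memLp_harmonizableKernel hH ht)]
  exact MemLp.coeFn_toLp _

lemma inner_kernelL2 (hH : H ∈ Ioo (0 : ℝ) 1) (ht : 0 ≤ t) (hH' : H' ∈ Ioo (0 : ℝ) 1)
    (hs : 0 ≤ s) : inner ℂ (kernelL2 s H') (kernelL2 t H) =
      ∫ u, harmonizableKernel t H u * (starRingEnd ℂ) (harmonizableKernel s H' u) := by
  rw [L2.inner_def]
  refine integral_congr_ae ?_
  filter_upwards [coeFn_kernelL2 hH ht, coeFn_kernelL2 hH' hs] with u h1 h2
  rw [h1, h2, RCLike.inner_apply]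

lemma inner_kernelL2_increments (hH : H ∈ Ioo (0 : ℝ) 1) (ht : 0 ≤ t)
    (hH' : H' ∈ Ioo (0 : ℝ) 1) (hs : 0 ≤ s) (hδ : 0 ≤ δ) :
    inner ℂ (kernelL2 (s + δ) H' - kernelL2 s H') (kernelL2 (t + δ) H - kernelL2 t H) =
      spectralCov δ (t - s) ((H + H') / 2) := by
  rw [L2.inner_def]
  refine integral_congr_ae ?_
  filter_upwards [coeFn_kernelL2 hH ht, coeFn_kernelL2 hH' hs,
    coeFn_kernelL2 hH (add_nonneg ht hδ), coeFn_kernelL2 hH' (add_nonneg hs hδ),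
    Lp.coeFn_sub (kernelL2 (s + δ) H') (kernelL2 s H'),
    Lp.coeFn_sub (kernelL2 (t + δ) H) (kernelL2 t H)] with u h1 h2 h3 h4 h5 h6
  rw [h5, h6, RCLike.inner_apply, Pi.sub_apply, Pi.sub_apply, h1, h2, h3, h4,
    increment_mul_conj]

lemma norm_kernelL2_increment (hH : H ∈ Ioo (0 : ℝ) 1) (ht : 0 ≤ t) (hδ : 0 ≤ δ) :
    ‖kernelL2 (t + δ) H - kernelL2 t H‖ ^ 2 = (spectralCov δ 0 H).re := by
  have h := inner_kernelL2_increments hH ht hH ht hδ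
  rw [sub_self, add_self_div_two] at h
  rw [← h, ← inner_self_eq_norm_sq (𝕜 := ℂ)]
  rfl

lemma norm_kernelL2_le (hα : 0 < α) (hβ : β < 1) (hH : H ∈ Icc α β) (ht : t ∈ Icc (0 : ℝ) 1) :
    ‖kernelL2 t H‖ ≤ √(∫ u, domWeight α β u) := by
  have hI : H ∈ Ioo (0 : ℝ) 1 := ⟨hα.trans_le hH.1, hH.2.trans_lt hβ⟩
  -- the kernel is its own increment from time `0`
  have h0 : kernelL2 0 H = 0 := by
    refine (Lp.ext ?_)
    filter_upwards [coeFn_kernelL2 hI le_rfl, Lp.coeFn_zero ℂ 2 (volume : Measure ℝ)] with u h1 h2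
    rw [h1, h2]
    simp [harmonizableKernel]
  have h := norm_kernelL2_increment hI le_rfl ht.1
  rw [zero_add, h0, sub_zero] at h
  refine Real.le_sqrt_of_sq_le ?_
  rw [h]
  refine (Complex.re_le_norm _).trans ((norm_spectralCov_le hα hβ hH ht.1 0).trans ?_)
  rw [max_eq_left ht.2, one_pow, one_mul]

lemma exists_norm_kernelL2_sub_le (hα : 0 < α) (hαβ : α ≤ β) (hβ : β < 1) :
    ∃ C : ℝ, 0 ≤ C ∧ ∀ t ∈ Icc (0 : ℝ) 1, ∀ H ∈ Icc α β, ∀ H' ∈ Icc α β,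
      ‖kernelL2 t H - kernelL2 t H'‖ ≤ C * |H - H'| := by
  set c := 1 / (α / 2) + 1 / ((1 - β) / 2) with hc
  have hβ' : 0 < 1 - β := by linarith
  have hc0 : 0 ≤ c := by positivity
  have hD : 0 ≤ ∫ u, domWeight α β u := integral_nonneg (domWeight_nonneg α β)
  refine ⟨c * √(2 * ∫ u, domWeight α β u), by positivity, fun t ht H hH H' hH' => ?_⟩
  have hI : H ∈ Ioo (0 : ℝ) 1 := ⟨hα.trans_le hH.1, hH.2.trans_lt hβ⟩
  have hI' : H' ∈ Ioo (0 : ℝ) 1 := ⟨hα.trans_le hH'.1, hH'.2.trans_lt hβ⟩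
  have hsq : ‖kernelL2 t H - kernelL2 t H'‖ ^ 2 =
      ∫ u, ‖harmonizableKernel t H u - harmonizableKernel t H' u‖ ^ 2 := by
    rw [← inner_self_eq_norm_sq (𝕜 := ℂ), L2.inner_def, ← Complex.ofReal_re (∫ u, _)]
    refine congrArg Complex.re ?_
    rw [← integral_complex_ofReal]
    refine integral_congr_ae ?_
    filter_upwards [coeFn_kernelL2 hI ht.1, coeFn_kernelL2 hI' ht.1,
      Lp.coeFn_sub (kernelL2 t H) (kernelL2 t H')] with u h1 h2 h3
    rw [h3, Pi.sub_apply, h1, h2, inner_self_eq_norm_sq_to_K]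
    push_cast
    rfl
  have hle : ‖kernelL2 t H - kernelL2 t H'‖ ^ 2 ≤
      (|H - H'| * c) ^ 2 * 2 * ∫ u, domWeight α β u := by
    rw [hsq, ← integral_const_mul]
    exact integral_mono_of_nonneg (Eventually.of_forall fun u => by positivity)
      ((integrable_domWeight hα hαβ hβ).const_mul _)
      (Eventually.of_forall fun u => sq_norm_harmonizableKernel_sub_le ht hα hβ hH hH' u)
  refine abs_le_of_sq_le_sq' (hle.trans (le_of_eq ?_)) (by positivity) |>.2
  rw [mul_pow (c * _), mul_pow c, Real.sq_sqrt (by positivity)]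
  ring

end Kernel

/-! ### The normalising constant -/

section NormConst

/-- A formula for `c_H` without a case distinction: the factor `cos (π H) / (1 - 2 H)` is
`(π / 2) sinc (π (1 / 2 - H))`, which is smooth across `H = 1 / 2`. -/
lemma normConst_eq {H : ℝ} : normConst H =
    √(2 * Real.pi * Real.sinc (Real.pi * (1 / 2 - H)) * Real.Gamma (2 - 2 * H) / (2 * H)) := by
  unfold normConst
  split_ifs with h
  · subst h
    norm_num
  · have h1 : 1 / 2 - H ≠ 0 := sub_ne_zero.2 (Ne.symm h)
    have h2 : Real.pi * (1 / 2 - H) ≠ 0 := mul_ne_zero Real.pi_ne_zero h1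
    have h3 : Real.sin (Real.pi * (1 / 2 - H)) = Real.cos (Real.pi * H) := by
      rw [← Real.sin_pi_div_two_sub]; congr 1; ring
    have h4 : 1 - 2 * H ≠ 0 := by
      intro h5; apply h1; linarith
    rw [Real.sinc_of_ne_zero h2, h3]
    congr 1
    rcases eq_or_ne H 0 with rfl | hH
    · simp
    · have h5 : (1 - H * 2) ≠ 0 := by rwa [mul_comm H 2]
      field_simp

lemma contDiff_sinc : ContDiff ℝ 1 Real.sinc := by
  refine contDiff_iff_contDiffAt.2 fun x => ?_
  rcases eq_or_ne x 0 with rfl | hx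
  · obtain ⟨p, hp⟩ := Real.analyticAt_sin (x := 0)
    rw [Real.sinc_eq_dslope]
    exact (AnalyticAt.contDiffAt ⟨_, hp.has_fpower_series_dslope_fslope⟩)
  · refine (Real.contDiff_sin.contDiffAt.div contDiffAt_id hx).congr_of_eventuallyEq ?_
    filter_upwards [isOpen_ne.mem_nhds hx] with y hy
    exact Real.sinc_of_ne_zero hy

lemma sinc_pos {x : ℝ} (h₁ : -Real.pi < x) (h₂ : x < Real.pi) : 0 < Real.sinc x := by
  rcases lt_trichotomy x 0 with hx | rfl | hx
  · rw [← Real.sinc_neg, Real.sinc_of_ne_zero (neg_ne_zero.2 hx.ne)]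
    exact div_pos (Real.sin_pos_of_pos_of_lt_pi (by linarith) (by linarith)) (by linarith)
  · simp
  · rw [Real.sinc_of_ne_zero hx.ne']
    exact div_pos (Real.sin_pos_of_pos_of_lt_pi hx h₂) hx

lemma contDiffAt_Gamma {x : ℝ} (hx : 0 < x) : ContDiffAt ℝ 1 Real.Gamma x := by
  have hd : DifferentiableOn ℂ Complex.Gamma {z | 0 < z.re} := fun z hz =>
    (Complex.differentiableAt_Gamma z fun m h => by
      have h1 : 0 < z.re := hz
      rw [h] at h1
      simp only [Complex.neg_re, Complex.natCast_re] at h1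
      have : (0 : ℝ) ≤ m := Nat.cast_nonneg m
      linarith).differentiableWithinAt
  have ha : AnalyticAt ℂ Complex.Gamma (x : ℂ) :=
    hd.analyticAt ((isOpen_lt continuous_const Complex.continuous_re).mem_nhds (by simpa using hx))
  exact ha.contDiffAt.real_of_complex

lemma normConst_sq_pos {H : ℝ} (hH : H ∈ Ioo (0 : ℝ) 1) :
    0 < 2 * Real.pi * Real.sinc (Real.pi * (1 / 2 - H)) * Real.Gamma (2 - 2 * H) / (2 * H) := by
  have h1 : 0 < Real.Gamma (2 - 2 * H) := Real.Gamma_pos_of_pos (by linarith [hH.2])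
  have hpi := Real.pi_pos
  have h2 : 0 < Real.sinc (Real.pi * (1 / 2 - H)) :=
    sinc_pos (by nlinarith [hH.2]) (by nlinarith [hH.1])
  have := hH.1
  positivity

lemma normConst_pos {H : ℝ} (hH : H ∈ Ioo (0 : ℝ) 1) : 0 < normConst H := by
  rw [normConst_eq]
  exact Real.sqrt_pos.2 (normConst_sq_pos hH)

lemma contDiffAt_normConst {H : ℝ} (hH : H ∈ Ioo (0 : ℝ) 1) : ContDiffAt ℝ 1 normConst H := by
  have e : normConst = fun H => √(2 * Real.pi * Real.sinc (Real.pi * (1 / 2 - H)) *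
    Real.Gamma (2 - 2 * H) / (2 * H)) := funext fun H => normConst_eq
  rw [e]
  refine ContDiffAt.sqrt ?_ (normConst_sq_pos hH).ne'
  have hG : ContDiffAt ℝ 1 (fun H => Real.Gamma (2 - 2 * H)) H :=
    ContDiffAt.comp (g := Real.Gamma) (f := fun H => 2 - 2 * H) H
      (contDiffAt_Gamma (by linarith [hH.2]))
      (contDiffAt_const.sub (contDiffAt_const.mul contDiffAt_id))
  have hS : ContDiffAt ℝ 1 (fun H => Real.sinc (Real.pi * (1 / 2 - H))) H :=
    ContDiffAt.comp (g := Real.sinc) (f := fun H => Real.pi * (1 / 2 - H)) H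
      contDiff_sinc.contDiffAt
      (contDiffAt_const.mul (contDiffAt_const.sub contDiffAt_id))
  exact ((contDiffAt_const.mul hS).mul hG).div (contDiffAt_const.mul contDiffAt_id)
    (by simp [hH.1.ne'])

lemma exists_lipschitzOn_inv_normConst {α β : ℝ} (hα : 0 < α) (hβ : β < 1) :
    ∃ C : ℝ, 0 ≤ C ∧ (∀ H ∈ Icc α β, 1 / normConst H ≤ C) ∧
      ∀ H ∈ Icc α β, ∀ H' ∈ Icc α β, |1 / normConst H - 1 / normConst H'| ≤ C * |H - H'| := by
  have hI : ∀ H ∈ Icc α β, H ∈ Ioo (0 : ℝ) 1 := fun H hH =>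
    ⟨hα.trans_le hH.1, hH.2.trans_lt hβ⟩
  have hd : ContDiffOn ℝ 1 (fun H => 1 / normConst H) (Icc α β) := fun H hH =>
    (contDiffAt_const.div (contDiffAt_normConst (hI H hH))
      (normConst_pos (hI H hH)).ne').contDiffWithinAt
  obtain ⟨K, hK⟩ := hd.exists_lipschitzOnWith one_ne_zero (convex_Icc α β) isCompact_Icc
  obtain ⟨M, hM⟩ := isCompact_Icc.exists_bound_of_continuousOn hd.continuousOn
  refine ⟨max K M, le_max_of_le_left K.2, fun H hH => ?_, fun H hH H' hH' => ?_⟩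
  · exact (le_abs_self _).trans ((hM H hH).trans (le_max_right _ _))
  · refine (hK.dist_le_mul H hH H' hH').trans ?_
    rw [Real.dist_eq]
    gcongr
    exact le_max_left _ _

end NormConst

/-! ### Covariances of the increments of multifractional Brownian motion -/

section Covariance

variable {Ω : Type*} [MeasurableSpace Ω] {P : Measure Ω} {W : Set ℝ → Ω → ℂ}
  {h : ℝ → ℝ} {B : ℝ → Ω → ℝ}

/-- The element of `L²(ℝ; ℂ)` whose stochastic integral is the value at time `t` of the
multifractional Brownian motion with functional parameter `h`. -/
noncomputable def mbmL2 (h : ℝ → ℝ) (t : ℝ) : Lp ℂ 2 (volume : Measure ℝ) :=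
  ((1 / normConst (h t) : ℝ) : ℂ) • kernelL2 t (h t)

namespace IsMultifracBM

lemma mem_l2Closure (hW : IsComplexGaussianMeasure P W) (hB : IsMultifracBM P W h B) {t : ℝ}
    (ht : t ∈ Icc (0 : ℝ) 1) : B t ∈ l2Closure P (elementarySpace W) := by
  obtain ⟨Y, hY, hBY⟩ := hB t ht
  refine l2Closure_congr (hY.re_mul_mem_l2Closure hW (1 / (normConst (h t) : ℂ))) ?_
  filter_upwards [hBY] with ω hω
  rw [← hω, Complex.ofReal_re]

lemma integral_mul (hW : IsComplexGaussianMeasure P W) (hB : IsMultifracBM P W h B)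
    (h_range : ∀ t ∈ Icc (0 : ℝ) 1, h t ∈ Ioo (0 : ℝ) 1) {t s : ℝ}
    (ht : t ∈ Icc (0 : ℝ) 1) (hs : s ∈ Icc (0 : ℝ) 1) :
    ∫ ω, B t ω * B s ω ∂P = (inner ℂ (mbmL2 h s) (mbmL2 h t)).re := by
  obtain ⟨Y, hY, hBY⟩ := hB t ht
  obtain ⟨Z, hZ, hBZ⟩ := hB s hs
  have key : ((∫ ω, B t ω * B s ω ∂P : ℝ) : ℂ) = inner ℂ (mbmL2 h s) (mbmL2 h t) := by
    rw [← integral_complex_ofReal, mbmL2, mbmL2, inner_smul_left, inner_smul_right,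
      inner_kernelL2 (h_range t ht) ht.1 (h_range s hs) hs.1, ← hY.integral_mul_conj hW hZ,
      Complex.conj_ofReal, ← mul_assoc, ← integral_const_mul]
    refine integral_congr_ae ?_
    filter_upwards [hBY, hBZ] with ω h1 h2
    have h2' := congrArg (starRingEnd ℂ) h2
    rw [Complex.conj_ofReal] at h2'
    rw [Complex.ofReal_mul, h1, h2', map_mul, map_div₀, map_one, Complex.conj_ofReal]
    push_cast
    ring
  rw [← key, Complex.ofReal_re]

lemma integral_increment_mul [IsProbabilityMeasure P] (hW : IsComplexGaussianMeasure P W)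
    (hB : IsMultifracBM P W h B) (h_range : ∀ t ∈ Icc (0 : ℝ) 1, h t ∈ Ioo (0 : ℝ) 1)
    {t t' s s' : ℝ} (ht : t ∈ Icc (0 : ℝ) 1) (ht' : t' ∈ Icc (0 : ℝ) 1)
    (hs : s ∈ Icc (0 : ℝ) 1) (hs' : s' ∈ Icc (0 : ℝ) 1) :
    ∫ ω, (B t' ω - B t ω) * (B s' ω - B s ω) ∂P =
      (inner ℂ (mbmL2 h s' - mbmL2 h s) (mbmL2 h t' - mbmL2 h t)).re := by
  have hG := hW.isGaussianSpace_elementarySpace.l2Closure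
  have hint : ∀ {t s : ℝ}, t ∈ Icc (0 : ℝ) 1 → s ∈ Icc (0 : ℝ) 1 →
      Integrable (fun ω => B t ω * B s ω) P := fun ht hs =>
    hG.integrable_mul (hB.mem_l2Closure hW ht) (hB.mem_l2Closure hW hs)
  have e : ∀ ω, (B t' ω - B t ω) * (B s' ω - B s ω) =
      (B t' ω * B s' ω - B t' ω * B s ω) - (B t ω * B s' ω - B t ω * B s ω) := fun ω => by ring
  have hint₂ : ∀ {t : ℝ}, t ∈ Icc (0 : ℝ) 1 →
      Integrable (fun ω => B t ω * B s' ω - B t ω * B s ω) P := fun ht =>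
    (hint ht hs').sub (hint ht hs)
  simp only [e]
  rw [integral_sub (hint₂ ht') (hint₂ ht),
    integral_sub (hint ht' hs') (hint ht' hs), integral_sub (hint ht hs') (hint ht hs),
    hB.integral_mul hW h_range ht' hs', hB.integral_mul hW h_range ht' hs,
    hB.integral_mul hW h_range ht hs', hB.integral_mul hW h_range ht hs]
  simp only [inner_sub_left, inner_sub_right, Complex.sub_re]

end IsMultifracBM

lemma norm_inner_add_add_sub_le {E : Type*} [NormedAddCommGroup E] [InnerProductSpace ℂ E]
    (x r y r' : E) : ‖inner ℂ (x + r) (y + r') - inner ℂ x y‖ ≤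
      ‖r‖ * ‖y‖ + ‖x‖ * ‖r'‖ + ‖r‖ * ‖r'‖ := by
  have e : inner ℂ (x + r) (y + r') - inner ℂ x y =
      inner ℂ r y + inner ℂ x r' + inner ℂ r r' := by
    simp only [inner_add_left, inner_add_right]; ring
  rw [e]
  refine (norm_add₃_le).trans ?_
  gcongr <;> exact norm_inner_le_norm _ _

variable {α β : ℝ}

/-- Freezing the Hurst index at the left end point of an increment costs an error of the order
of the length of the increment. -/
lemma exists_norm_mbmL2_increment_sub_le (hα : 0 < α) (hβ : β < 1) {L : ℝ}
    (hh : ∀ t ∈ Icc (0 : ℝ) 1, h t ∈ Icc α β)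
    (hL : ∀ t ∈ Icc (0 : ℝ) 1, ∀ s ∈ Icc (0 : ℝ) 1, |h t - h s| ≤ L * |t - s|) :
    ∃ C : ℝ, 0 ≤ C ∧ ∀ t ∈ Icc (0 : ℝ) 1, ∀ t' ∈ Icc (0 : ℝ) 1,
      ‖mbmL2 h t' - mbmL2 h t -
        ((1 / normConst (h t) : ℝ) : ℂ) • (kernelL2 t' (h t) - kernelL2 t (h t))‖ ≤
          C * |t' - t| := by
  have h0 : (0 : ℝ) ∈ Icc (0 : ℝ) 1 := ⟨le_rfl, zero_le_one⟩
  have hαβ : α ≤ β := (hh 0 h0).1.trans (hh 0 h0).2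
  obtain ⟨C₁, hC₁, hK⟩ := exists_norm_kernelL2_sub_le hα hαβ hβ
  obtain ⟨C₂, hC₂, hc, hc'⟩ := exists_lipschitzOn_inv_normConst hα hβ
  set D := √(∫ u, domWeight α β u) with hD
  have hD0 : 0 ≤ D := Real.sqrt_nonneg _
  refine ⟨(C₂ * C₁ + C₂ * D) * |L|, by positivity, fun t ht t' ht' => ?_⟩
  have e : mbmL2 h t' - mbmL2 h t -
        ((1 / normConst (h t) : ℝ) : ℂ) • (kernelL2 t' (h t) - kernelL2 t (h t)) =
      ((1 / normConst (h t') : ℝ) : ℂ) • (kernelL2 t' (h t') - kernelL2 t' (h t)) +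
        ((1 / normConst (h t') - 1 / normConst (h t) : ℝ) : ℂ) • kernelL2 t' (h t) := by
    rw [mbmL2, mbmL2, Complex.ofReal_sub]
    module
  have hpos : 0 < normConst (h t') :=
    normConst_pos ⟨hα.trans_le (hh t' ht').1, (hh t' ht').2.trans_lt hβ⟩
  have hLL : |h t' - h t| ≤ |L| * |t' - t| :=
    (hL t' ht' t ht).trans (mul_le_mul_of_nonneg_right (le_abs_self L) (abs_nonneg _))
  rw [e]
  refine (norm_add_le _ _).trans ?_
  rw [norm_smul, norm_smul, Complex.norm_real, Complex.norm_real, Real.norm_eq_abs,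
    Real.norm_eq_abs, abs_of_pos (one_div_pos.2 hpos)]
  calc _ ≤ C₂ * (C₁ * |h t' - h t|) + C₂ * |h t' - h t| * D := by
        gcongr
        · exact hc _ (hh t' ht')
        · exact hK t' ht' _ (hh t' ht') _ (hh t ht)
        · exact hc' _ (hh t' ht') _ (hh t ht)
        · exact norm_kernelL2_le hα hβ (hh t ht) ht'
    _ = (C₂ * C₁ + C₂ * D) * |h t' - h t| := by ring
    _ ≤ (C₂ * C₁ + C₂ * D) * (|L| * |t' - t|) := by gcongr
    _ = _ := by ring

lemma spectralCov_grid {n : ℕ} (hn : 0 < n) (k m H : ℝ) :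
    spectralCov (k / n) (m / n) H = ((n : ℝ) ^ (-(2 * H)) : ℝ) * spectralCov k m H := by
  have hn' : (0 : ℝ) < n := Nat.cast_pos.2 hn
  rw [div_eq_inv_mul, div_eq_inv_mul, spectralCov_mul_left (inv_pos.2 hn'),
    Real.inv_rpow hn'.le, Real.rpow_neg hn'.le]

/-- On the grid of mesh `1 / n`, the covariances of the increments of multifractional Brownian
motion are those of fractional Brownian motion with the mean of the two local Hurst indices, up
to a relative error of order `n ^ (-(1 - β))`. -/
lemma IsMultifracBM.exists_covariance_approx [IsProbabilityMeasure P]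
    (hW : IsComplexGaussianMeasure P W) (hB : IsMultifracBM P W h B)
    (hα : 0 < α) (hβ : β < 1) {L : ℝ} (hh : ∀ t ∈ Icc (0 : ℝ) 1, h t ∈ Icc α β)
    (hL : ∀ t ∈ Icc (0 : ℝ) 1, ∀ s ∈ Icc (0 : ℝ) 1, |h t - h s| ≤ L * |t - s|) (k : ℕ) :
    ∃ C : ℝ, 0 ≤ C ∧ ∀ n : ℕ, 0 < n → ∀ i j : ℕ, i + k ≤ n → j + k ≤ n →
      |∫ ω, (B (((i : ℝ) + k) / n) ω - B ((i : ℝ) / n) ω) *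
          (B (((j : ℝ) + k) / n) ω - B ((j : ℝ) / n) ω) ∂P -
        (n : ℝ) ^ (-(h ((i : ℝ) / n) + h ((j : ℝ) / n))) *
          (1 / normConst (h ((i : ℝ) / n)) * (1 / normConst (h ((j : ℝ) / n))) *
            (spectralCov k ((i : ℝ) - j) ((h ((i : ℝ) / n) + h ((j : ℝ) / n)) / 2)).re)| ≤
        (n : ℝ) ^ (-(h ((i : ℝ) / n) + h ((j : ℝ) / n))) * (C * (n : ℝ) ^ (-(1 - β))) := by
  obtain ⟨C₁, hC₁, hR⟩ := exists_norm_mbmL2_increment_sub_le hα hβ hh hL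
  obtain ⟨C₂, hC₂, hc, -⟩ := exists_lipschitzOn_inv_normConst hα hβ
  have hI : ∀ t ∈ Icc (0 : ℝ) 1, h t ∈ Ioo (0 : ℝ) 1 := fun t ht =>
    ⟨hα.trans_le (hh t ht).1, (hh t ht).2.trans_lt hβ⟩
  have hk : (0 : ℝ) ≤ k := Nat.cast_nonneg k
  set D := √(max 1 (k : ℝ) ^ 2 * ∫ u, domWeight α β u) with hD
  have hD0 : 0 ≤ D := Real.sqrt_nonneg _
  set a := C₁ * k with ha
  set b := C₂ * D with hb
  have ha0 : 0 ≤ a := by positivity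
  have hb0 : 0 ≤ b := by positivity
  refine ⟨a * b + b * a + a * a, by positivity, fun n hn i j hi hj => ?_⟩
  have hn' : (0 : ℝ) < n := Nat.cast_pos.2 hn
  have hn1 : (1 : ℝ) ≤ n := Nat.one_le_cast.2 hn
  have hgrid : ∀ i : ℕ, i + k ≤ n →
      (i : ℝ) / n ∈ Icc (0 : ℝ) 1 ∧ ((i : ℝ) + k) / n ∈ Icc (0 : ℝ) 1 := by
    intro i hi
    have hi' : (i : ℝ) + k ≤ n := by exact_mod_cast hi
    refine ⟨⟨by positivity, (div_le_one hn').2 (by linarith)⟩, ⟨by positivity,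
      (div_le_one hn').2 hi'⟩⟩
  -- each increment is `x i + r i`, with frozen Hurst index in `x i` and remainder `r i`
  set x : ℕ → Lp ℂ 2 (volume : Measure ℝ) := fun i =>
    ((1 / normConst (h ((i : ℝ) / n)) : ℝ) : ℂ) •
      (kernelL2 (((i : ℝ) + k) / n) (h ((i : ℝ) / n)) - kernelL2 ((i : ℝ) / n) (h ((i : ℝ) / n)))
    with hx
  set r : ℕ → Lp ℂ 2 (volume : Measure ℝ) := fun i =>
    mbmL2 h (((i : ℝ) + k) / n) - mbmL2 h ((i : ℝ) / n) - x i with hr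
  have hγ : (n : ℝ) ^ (-(1 - β)) ≤ 1 := Real.rpow_le_one_of_one_le_of_nonpos hn1 (by linarith)
  have hγ0 : 0 < (n : ℝ) ^ (-(1 - β)) := Real.rpow_pos_of_pos hn' _
  -- `1 / n` is at most `n ^ (-h)` times `n ^ (-(1 - β))`, since `h ≤ β`
  have hrn : ∀ i : ℕ, i + k ≤ n →
      ‖r i‖ ≤ a * ((n : ℝ) ^ (-h ((i : ℝ) / n)) * (n : ℝ) ^ (-(1 - β))) := by
    intro i hi
    obtain ⟨h1, h2⟩ := hgrid i hi
    refine (hR _ h1 _ h2).trans ?_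
    rw [← sub_div, add_sub_cancel_left, abs_of_nonneg (by positivity), ha, mul_assoc, div_eq_mul_inv]
    gcongr
    rw [← Real.rpow_add hn', ← Real.rpow_neg_one]
    exact Real.rpow_le_rpow_of_exponent_le hn1 (by linarith [(hh _ h1).2])
  have hadd : ∀ i : ℕ, ((i : ℝ) + k) / n = (i : ℝ) / n + k / n := fun i => add_div _ _ _
  have hxn : ∀ i : ℕ, i + k ≤ n → ‖x i‖ ≤ b * (n : ℝ) ^ (-h ((i : ℝ) / n)) := by
    intro i hi
    obtain ⟨h1, h2⟩ := hgrid i hi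
    have hpos := normConst_pos (hI _ h1)
    have h3 := norm_kernelL2_increment (hI _ h1) h1.1 (δ := k / n) (by positivity)
    have h4 := spectralCov_grid hn k 0 (h ((i : ℝ) / n))
    rw [zero_div] at h4
    rw [h4, Complex.re_ofReal_mul] at h3
    rw [hx, norm_smul, Complex.norm_real, Real.norm_of_nonneg (by positivity), hb, mul_assoc]
    refine mul_le_mul (hc _ (hh _ h1)) ?_ (norm_nonneg _) hC₂
    refine (abs_le_of_sq_le_sq' ?_ (by positivity)).2
    rw [hadd, h3, mul_pow, hD, Real.sq_sqrt (mul_nonneg (by positivity)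
      (integral_nonneg (domWeight_nonneg α β))), ← Real.rpow_mul_natCast hn'.le, mul_comm]
    refine mul_le_mul ((Complex.re_le_norm _).trans (norm_spectralCov_le hα hβ (hh _ h1) hk 0))
      (le_of_eq ?_) (by positivity) (mul_nonneg (by positivity)
      (integral_nonneg (domWeight_nonneg α β)))
    congr 1
    push_cast
    ring
  obtain ⟨hi1, hi2⟩ := hgrid i hi
  obtain ⟨hj1, hj2⟩ := hgrid j hj
  have hinner : inner ℂ (x j) (x i) = (((n : ℝ) ^ (-(h ((i : ℝ) / n) + h ((j : ℝ) / n))) *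
      (1 / normConst (h ((i : ℝ) / n)) * (1 / normConst (h ((j : ℝ) / n)))) : ℝ) : ℂ) *
        spectralCov k ((i : ℝ) - j) ((h ((i : ℝ) / n) + h ((j : ℝ) / n)) / 2) := by
    rw [hx, inner_smul_left, inner_smul_right, hadd, hadd, inner_kernelL2_increments (hI _ hi1)
      hi1.1 (hI _ hj1) hj1.1 (by positivity), ← sub_div, spectralCov_grid hn, mul_div_cancel₀ _
      (two_ne_zero' ℝ), Complex.conj_ofReal]
    push_cast
    ring
  have hre : (n : ℝ) ^ (-(h ((i : ℝ) / n) + h ((j : ℝ) / n))) *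
          (1 / normConst (h ((i : ℝ) / n)) * (1 / normConst (h ((j : ℝ) / n))) *
            (spectralCov k ((i : ℝ) - j) ((h ((i : ℝ) / n) + h ((j : ℝ) / n)) / 2)).re) =
      (inner ℂ (x j) (x i)).re := by
    rw [hinner, Complex.re_ofReal_mul, ← mul_assoc]
  have hsplit : ∀ i : ℕ, mbmL2 h (((i : ℝ) + k) / n) - mbmL2 h ((i : ℝ) / n) = x i + r i :=
    fun i => (add_sub_cancel _ _).symm
  rw [hB.integral_increment_mul hW hI hi1 hi2 hj1 hj2, hre, hsplit, hsplit, ← Complex.sub_re]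
  refine (Complex.abs_re_le_norm _).trans ((norm_inner_add_add_sub_le _ _ _ _).trans ?_)
  rw [neg_add, Real.rpow_add hn']
  set u := (n : ℝ) ^ (-h ((i : ℝ) / n)) with hu
  set v := (n : ℝ) ^ (-h ((j : ℝ) / n)) with hv
  set g := (n : ℝ) ^ (-(1 - β)) with hg
  have hu0 : 0 < u := Real.rpow_pos_of_pos hn' _
  have hv0 : 0 < v := Real.rpow_pos_of_pos hn' _
  calc _ ≤ a * (v * g) * (b * u) + b * v * (a * (u * g)) + a * (v * g) * (a * (u * 1)) := by
        gcongr
        · exact hrn j hj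
        · exact hxn i hi
        · exact hxn j hj
        · exact hrn i hi
        · exact hrn j hj
        · exact (hrn i hi).trans (by gcongr)
    _ = _ := by ring

end Covariance

/-! ### Concentration of the weights `n ^ (-2 h (i / n))` near the minimum of `h` -/

section GridSum

/-- The sum of the weights `n ^ (-2 h (i / n))` over the increments of lag `k` on the grid of
mesh `1 / n`. -/
noncomputable def gridSum (h : ℝ → ℝ) (k n : ℕ) : ℝ :=
  ∑ i ∈ Finset.range (n + 1 - k), (n : ℝ) ^ (-(2 * h ((i : ℝ) / n)))

variable {h : ℝ → ℝ} {α β x₀ : ℝ} {k : ℕ}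

lemma div_mem_Icc_of_lt {n i : ℕ} (hk : 0 < k) (hi : i ∈ Finset.range (n + 1 - k)) :
    (i : ℝ) / n ∈ Icc (0 : ℝ) 1 := by
  rw [Finset.mem_range] at hi
  have h1 : (i : ℝ) ≤ n := by exact_mod_cast (by omega : i ≤ n)
  exact ⟨by positivity, div_le_one_of_le₀ h1 (Nat.cast_nonneg n)⟩

/-- Near a minimum point, `h` is almost minimal on a nondegenerate interval. -/
lemma exists_Icc_le_add (hcont : ContinuousOn h (Icc 0 1)) (hx₀ : x₀ ∈ Icc (0 : ℝ) 1)
    (hmin : h x₀ = α) {η : ℝ} (hη : 0 < η) :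
    ∃ u v : ℝ, 0 ≤ u ∧ u < v ∧ v < 1 ∧ ∀ t ∈ Icc u v, h t ≤ α + η := by
  obtain ⟨r, hr, H⟩ := Metric.continuousWithinAt_iff.1 (hcont x₀ hx₀) η hη
  have key : ∀ t ∈ Icc (0 : ℝ) 1, |t - x₀| < r → h t ≤ α + η := by
    intro t ht htx
    have h1 := H ht (by rwa [Real.dist_eq])
    rw [Real.dist_eq, hmin] at h1
    linarith [(abs_lt.1 h1).2]
  obtain ⟨h0, h1⟩ := hx₀
  have hm0 : 0 < min r 1 := lt_min hr one_pos
  have hm1 : min r 1 ≤ 1 := min_le_right _ _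
  have hmr : min r 1 ≤ r := min_le_left _ _
  rcases le_total x₀ (1 / 2) with hx | hx
  · refine ⟨x₀, x₀ + min r 1 / 4, h0, by linarith, by linarith, fun t ht => ?_⟩
    refine key t ⟨h0.trans ht.1, by linarith [ht.2]⟩ ?_
    rw [abs_of_nonneg (by linarith [ht.1])]
    linarith [ht.2]
  · refine ⟨x₀ - min r 1 / 2, x₀ - min r 1 / 4, by linarith, by linarith, by linarith,
      fun t ht => ?_⟩
    refine key t ⟨by linarith [ht.1], by linarith [ht.2]⟩ ?_
    rw [abs_sub_comm, abs_of_nonneg (by linarith [ht.2])]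
    linarith [ht.1]

lemma exists_mul_rpow_le_gridSum (hcont : ContinuousOn h (Icc 0 1)) (hx₀ : x₀ ∈ Icc (0 : ℝ) 1)
    (hmin : h x₀ = α) (k : ℕ) {η : ℝ} (hη : 0 < η) :
    ∃ c : ℝ, 0 < c ∧ ∀ᶠ n : ℕ in atTop, c * (n : ℝ) ^ (1 - 2 * α - 2 * η) ≤ gridSum h k n := by
  obtain ⟨u, v, hu, huv, hv, H⟩ := exists_Icc_le_add hcont hx₀ hmin hη
  refine ⟨(v - u) / 2, by linarith, ?_⟩
  have hlarge : ∀ C : ℝ, ∀ᶠ n : ℕ in atTop, C ≤ n := fun C =>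
    tendsto_natCast_atTop_atTop.eventually_ge_atTop C
  filter_upwards [hlarge (k / (1 - v)), hlarge (2 / (v - u)), eventually_ge_atTop 1] with n h1 h2 h3
  have hn : (0 : ℝ) < n := by exact_mod_cast h3
  have hn1 : (1 : ℝ) ≤ n := by exact_mod_cast h3
  rw [div_le_iff₀ (by linarith)] at h1 h2
  have hsub : Finset.Ico ⌈n * u⌉₊ ⌈n * v⌉₊ ⊆ Finset.range (n + 1 - k) := by
    intro i hi
    rw [Finset.mem_Ico, Nat.lt_ceil] at hi
    rw [Finset.mem_range]
    have h4 : (i : ℝ) + k < n := by nlinarith [hi.2]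
    have h5 : i + k < n := by exact_mod_cast h4
    omega
  have hcard : (v - u) / 2 * n ≤ ((Finset.Ico ⌈n * u⌉₊ ⌈n * v⌉₊).card : ℝ) := by
    rw [Nat.card_Ico]
    have h4 : n * v ≤ (⌈n * v⌉₊ : ℝ) := Nat.le_ceil _
    have h5 : (⌈n * u⌉₊ : ℝ) < n * u + 1 := Nat.ceil_lt_add_one (by positivity)
    have h6 : (⌈n * v⌉₊ : ℝ) ≤ ((⌈n * v⌉₊ - ⌈n * u⌉₊ : ℕ) : ℝ) + ⌈n * u⌉₊ := by
      exact_mod_cast (le_tsub_add : ⌈n * v⌉₊ ≤ ⌈n * v⌉₊ - ⌈n * u⌉₊ + ⌈n * u⌉₊)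
    nlinarith
  calc (v - u) / 2 * (n : ℝ) ^ (1 - 2 * α - 2 * η)
      = (v - u) / 2 * n * (n : ℝ) ^ (-(2 * (α + η))) := by
        rw [show 1 - 2 * α - 2 * η = 1 + -(2 * (α + η)) by ring, Real.rpow_add hn, Real.rpow_one,
          mul_assoc]
    _ ≤ ((Finset.Ico ⌈n * u⌉₊ ⌈n * v⌉₊).card : ℝ) * (n : ℝ) ^ (-(2 * (α + η))) := by gcongr
    _ = ∑ i ∈ Finset.Ico ⌈n * u⌉₊ ⌈n * v⌉₊, (n : ℝ) ^ (-(2 * (α + η))) := by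
        rw [Finset.sum_const, nsmul_eq_mul]
    _ ≤ ∑ i ∈ Finset.Ico ⌈n * u⌉₊ ⌈n * v⌉₊, (n : ℝ) ^ (-(2 * h ((i : ℝ) / n))) := by
        refine Finset.sum_le_sum fun i hi => Real.rpow_le_rpow_of_exponent_le hn1 ?_
        rw [Finset.mem_Ico, Nat.lt_ceil, Nat.ceil_le] at hi
        have := H ((i : ℝ) / n) ⟨by rw [le_div_iff₀ hn]; linarith [hi.1],
          by rw [div_le_iff₀ hn]; linarith [hi.2]⟩
        linarith
    _ ≤ gridSum h k n :=
        Finset.sum_le_sum_of_subset_of_nonneg hsub fun i _ _ => by positivity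

lemma eventually_gridSum_pos (hcont : ContinuousOn h (Icc 0 1)) (hx₀ : x₀ ∈ Icc (0 : ℝ) 1)
    (hmin : h x₀ = α) (k : ℕ) : ∀ᶠ n : ℕ in atTop, 0 < gridSum h k n := by
  obtain ⟨c, hc, H⟩ := exists_mul_rpow_le_gridSum hcont hx₀ hmin k one_pos
  filter_upwards [H, eventually_ge_atTop 1] with n h1 h2
  have hn : (0 : ℝ) < n := by exact_mod_cast h2
  exact (mul_pos hc (Real.rpow_pos_of_pos hn _)).trans_le h1

/-- The indices at which `h` exceeds its minimum by `ε` carry a negligible part of the weights: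
`n` of them contribute at most `n * n ^ (-2 α - 2 ε)`. -/
lemma tendsto_rpow_div_gridSum (hcont : ContinuousOn h (Icc 0 1)) (hx₀ : x₀ ∈ Icc (0 : ℝ) 1)
    (hmin : h x₀ = α) (k : ℕ) {ε : ℝ} (hε : 0 < ε) :
    Tendsto (fun n : ℕ => (n : ℝ) ^ (1 - 2 * α - 2 * ε) / gridSum h k n) atTop (𝓝 0) := by
  obtain ⟨c, hc, H⟩ := exists_mul_rpow_le_gridSum hcont hx₀ hmin k (half_pos hε)
  have hlim : Tendsto (fun n : ℕ => c⁻¹ * (n : ℝ) ^ (-ε)) atTop (𝓝 0) := by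
    simpa using ((tendsto_rpow_neg_atTop hε).comp tendsto_natCast_atTop_atTop).const_mul c⁻¹
  refine tendsto_of_tendsto_of_tendsto_of_le_of_le' tendsto_const_nhds hlim ?_ ?_
  · filter_upwards [eventually_gridSum_pos hcont hx₀ hmin k] with n hn
    positivity
  · filter_upwards [H, eventually_gridSum_pos hcont hx₀ hmin k, eventually_ge_atTop 1]
      with n h1 h2 h3
    have hn : (0 : ℝ) < n := by exact_mod_cast h3
    rw [div_le_iff₀ h2]
    calc (n : ℝ) ^ (1 - 2 * α - 2 * ε)
        = c⁻¹ * (n : ℝ) ^ (-ε) * (c * (n : ℝ) ^ (1 - 2 * α - 2 * (ε / 2))) := by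
          rw [mul_mul_mul_comm, inv_mul_cancel₀ hc.ne', one_mul, ← Real.rpow_add hn]
          congr 1; ring
      _ ≤ _ := by gcongr

/-- Weighted averages over the grid of a continuous function of the local Hurst index converge to
its value at the minimal index. -/
lemma tendsto_weighted_average (hcont : ContinuousOn h (Icc 0 1)) (hx₀ : x₀ ∈ Icc (0 : ℝ) 1)
    (hmin : h x₀ = α) (hh : ∀ t ∈ Icc (0 : ℝ) 1, h t ∈ Icc α β) (hk : 0 < k) {φ : ℝ → ℝ}
    (hφ : ContinuousOn φ (Icc α β)) :
    Tendsto (fun n : ℕ => (∑ i ∈ Finset.range (n + 1 - k),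
      (n : ℝ) ^ (-(2 * h ((i : ℝ) / n))) * φ (h ((i : ℝ) / n))) / gridSum h k n)
      atTop (𝓝 (φ α)) := by
  have hα : α ∈ Icc α β := hmin ▸ hh x₀ hx₀
  obtain ⟨M, hM⟩ := isCompact_Icc.exists_bound_of_continuousOn hφ
  have hM0 : 0 ≤ M := (norm_nonneg _).trans (hM α hα)
  rw [Metric.tendsto_atTop']
  intro ε hε
  obtain ⟨η, hη, H⟩ := Metric.continuousWithinAt_iff.1 (hφ α hα) (ε / 2) (half_pos hε)
  have hsmall := (tendsto_rpow_div_gridSum hcont hx₀ hmin k hη).const_mul (2 * M)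
  rw [mul_zero] at hsmall
  have hev := (hsmall.eventually_lt_const (half_pos hε)).and
    ((eventually_gridSum_pos hcont hx₀ hmin k).and (eventually_ge_atTop 1))
  obtain ⟨N, hN⟩ := eventually_atTop.1 hev
  refine ⟨N, fun n hn => ?_⟩
  obtain ⟨h1, h2, h3⟩ := hN n hn.le
  have hn0 : (0 : ℝ) < n := by exact_mod_cast h3
  have hn1 : (1 : ℝ) ≤ n := by exact_mod_cast h3
  rw [Real.dist_eq]
  have e : (∑ i ∈ Finset.range (n + 1 - k), (n : ℝ) ^ (-(2 * h ((i : ℝ) / n))) *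
      φ (h ((i : ℝ) / n))) / gridSum h k n - φ α = (∑ i ∈ Finset.range (n + 1 - k),
        (n : ℝ) ^ (-(2 * h ((i : ℝ) / n))) * (φ (h ((i : ℝ) / n)) - φ α)) / gridSum h k n := by
    simp only [mul_sub, Finset.sum_sub_distrib, ← Finset.sum_mul]
    rw [← gridSum, sub_div, mul_div_cancel_left₀ _ h2.ne']
  -- either `h (i / n)` is close to `α`, and so is the value of `φ`, or the weight is small
  have hterm : ∀ i ∈ Finset.range (n + 1 - k),
      |(n : ℝ) ^ (-(2 * h ((i : ℝ) / n))) * (φ (h ((i : ℝ) / n)) - φ α)| ≤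
        (n : ℝ) ^ (-(2 * h ((i : ℝ) / n))) * (ε / 2) + 2 * M * (n : ℝ) ^ (-2 * α - 2 * η) := by
    intro i hi
    have hi' := hh _ (div_mem_Icc_of_lt hk hi)
    set w := (n : ℝ) ^ (-(2 * h ((i : ℝ) / n))) with hw
    have hw0 : 0 < w := Real.rpow_pos_of_pos hn0 _
    rw [abs_mul, abs_of_pos hw0]
    rcases lt_or_ge (h ((i : ℝ) / n)) (α + η) with hlt | hge
    · have h4 := H hi' (by rw [Real.dist_eq, abs_of_nonneg (by linarith [hi'.1])]; linarith)
      rw [Real.dist_eq] at h4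
      have : 0 ≤ 2 * M * (n : ℝ) ^ (-2 * α - 2 * η) := by positivity
      nlinarith
    · have h4 : w ≤ (n : ℝ) ^ (-2 * α - 2 * η) :=
        Real.rpow_le_rpow_of_exponent_le hn1 (by linarith)
      have h5 : |φ (h ((i : ℝ) / n)) - φ α| ≤ 2 * M := by
        have h6 := hM _ hi'
        have h7 := hM α hα
        rw [Real.norm_eq_abs] at h6 h7
        linarith [abs_sub (φ (h ((i : ℝ) / n))) (φ α)]
      have h6 : w * |φ (h ((i : ℝ) / n)) - φ α| ≤ (n : ℝ) ^ (-2 * α - 2 * η) * (2 * M) := by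
        gcongr
      have : 0 ≤ w * (ε / 2) := by positivity
      linarith
  have hcard : ((n + 1 - k : ℕ) : ℝ) ≤ n := by exact_mod_cast (by omega : n + 1 - k ≤ n)
  have hpow : (n : ℝ) * (n : ℝ) ^ (-2 * α - 2 * η) = (n : ℝ) ^ (1 - 2 * α - 2 * η) := by
    nth_rewrite 1 [← Real.rpow_one (n : ℝ)]
    rw [← Real.rpow_add hn0]; congr 1; ring
  rw [e, abs_div, abs_of_pos h2, div_lt_iff₀ h2]
  have hsum : |∑ i ∈ Finset.range (n + 1 - k),
        (n : ℝ) ^ (-(2 * h ((i : ℝ) / n))) * (φ (h ((i : ℝ) / n)) - φ α)| ≤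
      gridSum h k n * (ε / 2) + 2 * M * (n : ℝ) ^ (1 - 2 * α - 2 * η) := by
    refine (Finset.abs_sum_le_sum_abs _ _).trans ((Finset.sum_le_sum hterm).trans ?_)
    rw [Finset.sum_add_distrib, ← Finset.sum_mul, ← gridSum, Finset.sum_const, Finset.card_range,
      nsmul_eq_mul, ← hpow]
    have : 0 ≤ 2 * M * (n : ℝ) ^ (-2 * α - 2 * η) := by positivity
    nlinarith
  rw [← mul_div_assoc, div_lt_iff₀ h2] at h1
  linarith

/-- A matrix of covariances which is of the order of the weights, and negligible with respect to
them away from the diagonal, has a sum of squares negligible with respect to the square of the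
sum of the weights. -/
lemma tendsto_sum_sq_div_gridSum_sq (hcont : ContinuousOn h (Icc 0 1))
    (hx₀ : x₀ ∈ Icc (0 : ℝ) 1) (hmin : h x₀ = α) (hh : ∀ t ∈ Icc (0 : ℝ) 1, α ≤ h t)
    (hk : 0 < k) {r : ℕ → ℕ → ℕ → ℝ} {A : ℝ}
    (hA : ∀ᶠ n : ℕ in atTop, ∀ i ∈ Finset.range (n + 1 - k), ∀ j ∈ Finset.range (n + 1 - k),
      |r n i j| ≤ (n : ℝ) ^ (-(h ((i : ℝ) / n) + h ((j : ℝ) / n))) * A)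
    (hr : ∀ ε : ℝ, 0 < ε → ∃ M : ℕ, ∀ᶠ n : ℕ in atTop, ∀ i ∈ Finset.range (n + 1 - k),
      ∀ j ∈ Finset.range (n + 1 - k), (j + M ≤ i ∨ i + M ≤ j) →
        |r n i j| ≤ (n : ℝ) ^ (-(h ((i : ℝ) / n) + h ((j : ℝ) / n))) * ε) :
    Tendsto (fun n : ℕ => (∑ i ∈ Finset.range (n + 1 - k), ∑ j ∈ Finset.range (n + 1 - k),
      r n i j ^ 2) / gridSum h k n ^ 2) atTop (𝓝 0) := by
  rw [Metric.tendsto_atTop']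
  intro ε hε
  obtain ⟨M, hM⟩ := hr (√(ε / 2)) (Real.sqrt_pos.2 (half_pos hε))
  -- the diagonal band contributes at most `2 M A² n ^ (-2 α)` times the sum of the weights
  have hsmall := (tendsto_rpow_div_gridSum hcont hx₀ hmin k (half_pos one_pos)).const_mul
    (2 * M * A ^ 2)
  rw [mul_zero] at hsmall
  have hev := (hsmall.eventually_lt_const (half_pos hε)).and
    ((eventually_gridSum_pos hcont hx₀ hmin k).and ((eventually_ge_atTop 1).and (hA.and hM)))
  obtain ⟨N, hN⟩ := eventually_atTop.1 hev
  refine ⟨N, fun n hn => ?_⟩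
  obtain ⟨h1, h2, h3, h4, h5⟩ := hN n hn.le
  have hn0 : (0 : ℝ) < n := by exact_mod_cast h3
  have hn1 : (1 : ℝ) ≤ n := by exact_mod_cast h3
  have hexp : 1 - 2 * α - 2 * (1 / 2) = -(2 * α) := by ring
  rw [hexp] at h1
  set w : ℕ → ℝ := fun i => (n : ℝ) ^ (-(2 * h ((i : ℝ) / n))) with hw
  have hw0 : ∀ i, 0 < w i := fun i => Real.rpow_pos_of_pos hn0 _
  have hwle : ∀ i ∈ Finset.range (n + 1 - k), w i ≤ (n : ℝ) ^ (-(2 * α)) := fun i hi =>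
    Real.rpow_le_rpow_of_exponent_le hn1 (by linarith [hh _ (div_mem_Icc_of_lt hk hi)])
  have hww : ∀ i j : ℕ, ((n : ℝ) ^ (-(h ((i : ℝ) / n) + h ((j : ℝ) / n)))) ^ 2 = w i * w j := by
    intro i j
    rw [hw, ← Real.rpow_mul_natCast hn0.le, ← Real.rpow_add hn0]
    congr 1; push_cast; ring
  set T : ℕ → Finset ℕ := fun i => Finset.Ico (i + 1 - M) (i + M) with hT
  have hterm : ∀ i ∈ Finset.range (n + 1 - k), ∀ j ∈ Finset.range (n + 1 - k),
      r n i j ^ 2 ≤ w i * w j * (ε / 2) +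
        if j ∈ T i then A ^ 2 * (w i * (n : ℝ) ^ (-(2 * α))) else 0 := by
    intro i hi j hj
    rw [← sq_abs]
    split_ifs with hjT
    · have h6 : |r n i j| ^ 2 ≤ ((n : ℝ) ^ (-(h ((i : ℝ) / n) + h ((j : ℝ) / n))) * A) ^ 2 := by
        have := h4 i hi j hj
        gcongr
      rw [mul_pow, hww] at h6
      have h7 : w i * w j * A ^ 2 ≤ w i * (n : ℝ) ^ (-(2 * α)) * A ^ 2 := by
        have := (hw0 i).le
        have := hwle j hj
        gcongr
      have := mul_pos (hw0 i) (hw0 j)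
      nlinarith
    · have hfar : j + M ≤ i ∨ i + M ≤ j := by
        simp only [hT, Finset.mem_Ico, not_and_or, not_le, not_lt] at hjT
        omega
      have h6 : |r n i j| ^ 2 ≤
          ((n : ℝ) ^ (-(h ((i : ℝ) / n) + h ((j : ℝ) / n))) * √(ε / 2)) ^ 2 := by
        have := h5 i hi j hj hfar
        gcongr
      rw [mul_pow, hww, Real.sq_sqrt (half_pos hε).le] at h6
      linarith
  have hcard : ∀ i, ((T i).card : ℝ) ≤ 2 * M := by
    intro i
    have : (T i).card ≤ 2 * M := by rw [hT, Nat.card_Ico]; omega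
    exact_mod_cast this
  have hinner : ∀ i ∈ Finset.range (n + 1 - k), ∑ j ∈ Finset.range (n + 1 - k), r n i j ^ 2 ≤
      w i * (gridSum h k n * (ε / 2) + 2 * M * A ^ 2 * (n : ℝ) ^ (-(2 * α))) := by
    intro i hi
    refine (Finset.sum_le_sum (hterm i hi)).trans ?_
    rw [Finset.sum_add_distrib, ← Finset.sum_mul, ← Finset.mul_sum, ← Finset.sum_filter,
      Finset.sum_const, nsmul_eq_mul]
    have h6 : (((Finset.range (n + 1 - k)).filter (· ∈ T i)).card : ℝ) ≤ 2 * M :=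
      le_trans (by exact_mod_cast Finset.card_le_card fun j hj => (Finset.mem_filter.1 hj).2)
        (hcard i)
    have h7 : 0 ≤ A ^ 2 * (w i * (n : ℝ) ^ (-(2 * α))) := by
      have := (hw0 i).le
      positivity
    have h8 := mul_le_mul_of_nonneg_right h6 h7
    have h9 : ∑ j ∈ Finset.range (n + 1 - k), w j = gridSum h k n := rfl
    rw [h9]
    linarith
  have htotal : ∑ i ∈ Finset.range (n + 1 - k), ∑ j ∈ Finset.range (n + 1 - k), r n i j ^ 2 ≤
      gridSum h k n * (gridSum h k n * (ε / 2) + 2 * M * A ^ 2 * (n : ℝ) ^ (-(2 * α))) := by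
    refine (Finset.sum_le_sum hinner).trans (le_of_eq ?_)
    rw [← Finset.sum_mul]
    rfl
  rw [Real.dist_eq, sub_zero, abs_of_nonneg (div_nonneg (Finset.sum_nonneg fun i _ =>
    Finset.sum_nonneg fun j _ => sq_nonneg _) (sq_nonneg _)), div_lt_iff₀ (by positivity)]
  rw [← mul_div_assoc, div_lt_iff₀ h2] at h1
  nlinarith

/-- The sums for the lags `1` and `2` differ by a single weight, which is negligible. -/
lemma tendsto_gridSum_one_div_two (hcont : ContinuousOn h (Icc 0 1))
    (hx₀ : x₀ ∈ Icc (0 : ℝ) 1) (hmin : h x₀ = α) (hh : ∀ t ∈ Icc (0 : ℝ) 1, α ≤ h t) :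
    Tendsto (fun n : ℕ => gridSum h 1 n / gridSum h 2 n) atTop (𝓝 1) := by
  have hsmall := tendsto_rpow_div_gridSum hcont hx₀ hmin 2 (half_pos one_pos)
  have hlim : Tendsto (fun n : ℕ => 1 + (n : ℝ) ^ (1 - 2 * α - 2 * (1 / 2)) / gridSum h 2 n) atTop
      (𝓝 1) := by simpa using hsmall.const_add 1
  have hev := (eventually_gridSum_pos hcont hx₀ hmin 2).and (eventually_ge_atTop 1)
  have hsplit : ∀ n : ℕ, 1 ≤ n → gridSum h 1 n =
      gridSum h 2 n + (n : ℝ) ^ (-(2 * h (((n - 1 : ℕ) : ℝ) / n))) := by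
    intro n hn
    obtain ⟨m, rfl⟩ := Nat.exists_eq_add_of_le' hn
    rw [gridSum, gridSum, show m + 1 + 1 - 1 = m + 1 by omega, show m + 1 + 1 - 2 = m by omega,
      Finset.sum_range_succ]
    rfl
  refine tendsto_of_tendsto_of_tendsto_of_le_of_le' tendsto_const_nhds hlim ?_ ?_
  · filter_upwards [hev] with n ⟨h1, h2⟩
    rw [one_le_div h1, hsplit n h2]
    have : 0 ≤ (n : ℝ) ^ (-(2 * h (((n - 1 : ℕ) : ℝ) / n))) := by positivity
    linarith
  · filter_upwards [hev] with n ⟨h1, h2⟩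
    have hn1 : (1 : ℝ) ≤ n := by exact_mod_cast h2
    rw [hsplit n h2, add_div, div_self h1.ne']
    gcongr 1 + ?_ / _
    refine Real.rpow_le_rpow_of_exponent_le hn1 ?_
    have := hh _ (div_mem_Icc_of_lt (k := 1) one_pos (n := n) (i := n - 1)
      (by rw [Finset.mem_range]; omega))
    linarith

end GridSum

/-! ### Consistency of the ratio statistic -/

section Consistency

variable {Ω : Type*} [MeasurableSpace Ω] {P : Measure Ω} {W : Set ℝ → Ω → ℂ}
  {h : ℝ → ℝ} {B : ℝ → Ω → ℝ}

/-- Continuous mapping for convergence in probability of a pair to constants, for a function that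
may also depend on `n`. -/
lemma tendstoInMeasure_map₂ {X Y : ℕ → Ω → ℝ} {x y c : ℝ} {g : ℕ → ℝ → ℝ → ℝ}
    (hX : TendstoInMeasure P X atTop fun _ => x) (hY : TendstoInMeasure P Y atTop fun _ => y)
    (hg : Tendsto (fun p : ℕ × ℝ × ℝ => g p.1 p.2.1 p.2.2) (atTop ×ˢ 𝓝 (x, y)) (𝓝 c)) :
    TendstoInMeasure P (fun n ω => g n (X n ω) (Y n ω)) atTop fun _ => c := by
  rw [tendstoInMeasure_iff_dist] at hX hY ⊢
  intro ε hε
  obtain ⟨p, hp, q, hq, H⟩ := eventually_prod_iff.1 (Metric.tendsto_nhds.1 hg ε hε)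
  obtain ⟨δ, hδ, hball⟩ := Metric.eventually_nhds_iff.1 hq
  have hlim := (hX δ hδ).add (hY δ hδ)
  rw [add_zero] at hlim
  refine tendsto_of_tendsto_of_tendsto_of_le_of_le' tendsto_const_nhds hlim
    (Eventually.of_forall fun _ => zero_le) ?_
  filter_upwards [hp] with n hn
  refine (measure_mono fun ω hω => ?_).trans (measure_union_le _ _)
  by_contra hcon
  simp only [mem_union, mem_ofPred_eq, not_or, not_le] at hcon hω
  exact absurd hω (not_le.2 (H hn (hball (y := (X n ω, Y n ω)) (max_lt hcon.1 hcon.2))))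

lemma continuousOn_re_spectralCov {α β : ℝ} (hα : 0 < α) (hβ : β < 1) (k m : ℝ) (hk : 0 ≤ k) :
    ContinuousOn (fun H => (spectralCov k m H).re) (Icc α β) := by
  obtain ⟨C, hC0, hC⟩ := exists_norm_spectralCov_sub_le (k := k) hα hβ hk
  have hL : LipschitzOnWith C.toNNReal (fun H => spectralCov k m H) (Icc α β) :=
    LipschitzOnWith.of_dist_le_mul fun H hH H' hH' => by
      rw [dist_eq_norm, Real.dist_eq, Real.coe_toNNReal C hC0]
      exact hC H hH H' hH' m
  exact Complex.continuous_re.comp_continuousOn hL.continuousOn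

/-- The law of large numbers for the quadratic variations: normalised by the sum of the weights
`n ^ (-2 h (i / n))`, they converge to the variance of a fractional increment of lag `k` with
the minimal Hurst index. -/
lemma IsMultifracBM.tendstoInMeasure_quadVar [IsProbabilityMeasure P]
    (hW : IsComplexGaussianMeasure P W) (hB : IsMultifracBM P W h B)
    {α β L x₀ : ℝ} (hα : 0 < α) (hβ : β < 1)
    (hh : ∀ t ∈ Icc (0 : ℝ) 1, h t ∈ Icc α β)
    (hL : ∀ t ∈ Icc (0 : ℝ) 1, ∀ s ∈ Icc (0 : ℝ) 1, |h t - h s| ≤ L * |t - s|)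
    (hcont : ContinuousOn h (Icc 0 1)) (hx₀ : x₀ ∈ Icc (0 : ℝ) 1) (hmin : h x₀ = α)
    {k : ℕ} (hk : 0 < k) :
    TendstoInMeasure P (fun n ω => quadVar B k n ω / gridSum h k n) atTop
      (fun _ => (k : ℝ) ^ (2 * α) * ((1 / normConst α) ^ 2 * (spectralCov 1 0 α).re)) := by
  have hI : ∀ t ∈ Icc (0 : ℝ) 1, h t ∈ Ioo (0 : ℝ) 1 := fun t ht =>
    ⟨hα.trans_le (hh t ht).1, (hh t ht).2.trans_lt hβ⟩
  have hk0 : (0 : ℝ) < k := Nat.cast_pos.2 hk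
  obtain ⟨C, hC, hcov⟩ := hB.exists_covariance_approx hW hα hβ hh hL k
  obtain ⟨C₂, hC₂, hc, -⟩ := exists_lipschitzOn_inv_normConst hα hβ
  set X : ℕ → ℕ → Ω → ℝ := fun n i ω => B (((i : ℝ) + k) / n) ω - B ((i : ℝ) / n) ω with hX
  have herr : Tendsto (fun n : ℕ => C * (n : ℝ) ^ (-(1 - β))) atTop (𝓝 0) := by
    simpa using ((tendsto_rpow_neg_atTop (sub_pos.2 hβ)).comp
      tendsto_natCast_atTop_atTop).const_mul C
  have hnorm : ∀ H ∈ Icc α β, 0 < 1 / normConst H := fun H hH =>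
    one_div_pos.2 (normConst_pos ⟨hα.trans_le hH.1, hH.2.trans_lt hβ⟩)
  have hlt : ∀ {n i : ℕ}, 0 < n → i ∈ Finset.range (n + 1 - k) → i + k ≤ n := fun hn hi => by
    rw [Finset.mem_range] at hi; omega
  -- a bound for the covariances in terms of the spectral covariance of the frozen increments
  have hbound : ∀ {n i j : ℕ} {D : ℝ}, 0 < n → i ∈ Finset.range (n + 1 - k) →
      j ∈ Finset.range (n + 1 - k) → 0 ≤ D →
      ‖spectralCov k ((i : ℝ) - j) ((h ((i : ℝ) / n) + h ((j : ℝ) / n)) / 2)‖ ≤ D →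
      |∫ ω, X n i ω * X n j ω ∂P| ≤ (n : ℝ) ^ (-(h ((i : ℝ) / n) + h ((j : ℝ) / n))) *
        (C₂ * C₂ * D + C * (n : ℝ) ^ (-(1 - β))) := by
    intro n i j D hn hi hj hD hs
    have h1 := hcov n hn i j (hlt hn hi) (hlt hn hj)
    have hi' := hh _ (div_mem_Icc_of_lt hk hi)
    have hj' := hh _ (div_mem_Icc_of_lt hk hj)
    have hpow : 0 ≤ (n : ℝ) ^ (-(h ((i : ℝ) / n) + h ((j : ℝ) / n))) := by positivity
    have h2 : |1 / normConst (h ((i : ℝ) / n)) * (1 / normConst (h ((j : ℝ) / n))) *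
        (spectralCov k ((i : ℝ) - j) ((h ((i : ℝ) / n) + h ((j : ℝ) / n)) / 2)).re| ≤
        C₂ * C₂ * D := by
      rw [abs_mul, abs_of_nonneg (mul_nonneg (hnorm _ hi').le (hnorm _ hj').le)]
      refine mul_le_mul (mul_le_mul (hc _ hi') (hc _ hj') (hnorm _ hj').le hC₂)
        ((Complex.abs_re_le_norm _).trans hs) (abs_nonneg _) (by positivity)
    have h3 := abs_sub_abs_le_abs_sub (∫ ω, X n i ω * X n j ω ∂P)
      ((n : ℝ) ^ (-(h ((i : ℝ) / n) + h ((j : ℝ) / n))) *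
          (1 / normConst (h ((i : ℝ) / n)) * (1 / normConst (h ((j : ℝ) / n))) *
            (spectralCov k ((i : ℝ) - j) ((h ((i : ℝ) / n) + h ((j : ℝ) / n)) / 2)).re))
    rw [abs_mul, abs_of_nonneg hpow] at h3
    have h4 := mul_le_mul_of_nonneg_left h2 hpow
    linarith
  have hmid : ∀ {n i j : ℕ}, i ∈ Finset.range (n + 1 - k) → j ∈ Finset.range (n + 1 - k) →
      (h ((i : ℝ) / n) + h ((j : ℝ) / n)) / 2 ∈ Icc α β := fun hi hj => by
    have hi' := hh _ (div_mem_Icc_of_lt hk hi)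
    have hj' := hh _ (div_mem_Icc_of_lt hk hj)
    exact ⟨by linarith [hi'.1, hj'.1], by linarith [hi'.2, hj'.2]⟩
  have hmean : Tendsto (fun n => (∑ i ∈ Finset.range (n + 1 - k), ∫ ω, X n i ω ^ 2 ∂P) /
      gridSum h k n) atTop
      (𝓝 ((k : ℝ) ^ (2 * α) * ((1 / normConst α) ^ 2 * (spectralCov 1 0 α).re))) := by
    have hφ : ContinuousOn (fun H => 1 / normConst H * (1 / normConst H) *
        (spectralCov k 0 H).re) (Icc α β) := by
      have h1 : ContinuousOn (fun H => 1 / normConst H) (Icc α β) := fun H hH =>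
        (contDiffAt_normConst ⟨hα.trans_le hH.1, hH.2.trans_lt hβ⟩).continuousAt.continuousWithinAt
          |> fun h2 => continuousWithinAt_const.div h2 (one_div_pos.1 (hnorm H hH)).ne'
      exact (h1.mul h1).mul (continuousOn_re_spectralCov hα hβ k 0 hk0.le)
    have hav := tendsto_weighted_average hcont hx₀ hmin hh hk hφ
    have hval : 1 / normConst α * (1 / normConst α) * (spectralCov k 0 α).re =
        (k : ℝ) ^ (2 * α) * ((1 / normConst α) ^ 2 * (spectralCov 1 0 α).re) := by
      have h1 := spectralCov_mul_left hk0 1 0 α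
      rw [mul_one, mul_zero] at h1
      rw [h1, Complex.re_ofReal_mul]
      ring
    rw [hval] at hav
    have hdiff : Tendsto (fun n : ℕ => (∑ i ∈ Finset.range (n + 1 - k), ∫ ω, X n i ω ^ 2 ∂P) /
        gridSum h k n - (∑ i ∈ Finset.range (n + 1 - k), (n : ℝ) ^ (-(2 * h ((i : ℝ) / n))) *
          (1 / normConst (h ((i : ℝ) / n)) * (1 / normConst (h ((i : ℝ) / n))) *
            (spectralCov k 0 (h ((i : ℝ) / n))).re)) / gridSum h k n) atTop (𝓝 0) := by
      refine squeeze_zero_norm' ?_ herr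
      filter_upwards [eventually_gridSum_pos hcont hx₀ hmin k, eventually_gt_atTop 0] with n h1 h2
      rw [← sub_div, ← Finset.sum_sub_distrib, norm_div, Real.norm_of_nonneg h1.le,
        div_le_iff₀ h1, mul_comm, gridSum, Finset.sum_mul]
      refine norm_sum_le_of_le _ fun i hi => ?_
      have h3 := hcov n h2 i i (hlt h2 hi) (hlt h2 hi)
      rw [sub_self, add_self_div_two, ← two_mul] at h3
      simpa only [Real.norm_eq_abs, pow_two] using h3
    simpa using hdiff.add hav
  have hcovs : Tendsto (fun n => (∑ i ∈ Finset.range (n + 1 - k), ∑ j ∈ Finset.range (n + 1 - k),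
      (∫ ω, X n i ω * X n j ω ∂P) ^ 2) / gridSum h k n ^ 2) atTop (𝓝 0) := by
    set D := max 1 (k : ℝ) ^ 2 * ∫ y, domWeight α β y with hD
    have hD0 : 0 ≤ D := mul_nonneg (by positivity) (integral_nonneg (domWeight_nonneg α β))
    refine tendsto_sum_sq_div_gridSum_sq hcont hx₀ hmin (fun t ht => (hh t ht).1) hk
      (A := C₂ * C₂ * D + 1) ?_ ?_
    · filter_upwards [eventually_gt_atTop 0, herr.eventually_le_const one_pos] with n hn h1 i hi j hj
      refine (hbound hn hi hj hD0 (norm_spectralCov_le hα hβ (hmid hi hj) hk0.le _)).trans ?_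
      gcongr
    · intro ε hε
      have hδ : 0 < ε / 2 / (C₂ * C₂ + 1) := by positivity
      -- the uniform Riemann-Lebesgue lemma controls the covariances at distance at least `M`
      have hRL := eventually_norm_spectralCov_le (k := k) hα hβ hk0.le hδ
      rw [← Metric.cobounded_eq_cocompact, ← comap_norm_atTop, eventually_comap] at hRL
      obtain ⟨a, ha⟩ := eventually_atTop.1 hRL
      obtain ⟨M, hM⟩ := exists_nat_ge a
      refine ⟨M, ?_⟩
      filter_upwards [eventually_gt_atTop 0, herr.eventually_le_const (half_pos hε)]
        with n hn h1 i hi j hj hij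
      have hdist : a ≤ ‖(i : ℝ) - j‖ := by
        refine hM.trans ?_
        rw [Real.norm_eq_abs]
        rcases hij with h2 | h2
        · have h3 : (j : ℝ) + M ≤ i := by exact_mod_cast h2
          exact le_trans (by linarith) (le_abs_self _)
        · have h3 : (i : ℝ) + M ≤ j := by exact_mod_cast h2
          exact le_trans (by linarith) (neg_le_abs _)
      refine (hbound hn hi hj hδ.le (ha _ hdist _ rfl _ (hmid hi hj))).trans ?_
      have h2 : C₂ * C₂ * (ε / 2 / (C₂ * C₂ + 1)) ≤ ε / 2 := by
        rw [mul_div_assoc', div_le_iff₀ (by positivity)]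
        nlinarith
      gcongr
      linarith
  have hmem : ∀ᶠ n : ℕ in atTop, ∀ i ∈ Finset.range (n + 1 - k),
      X n i ∈ l2Closure P (elementarySpace W) := by
    filter_upwards [eventually_gt_atTop 0] with n hn i hi
    have h1 : ((i : ℝ) + k) / n ∈ Icc (0 : ℝ) 1 := by
      have : ((i : ℝ) + k) ≤ n := by exact_mod_cast hlt hn hi
      exact ⟨by positivity, div_le_one_of_le₀ this (Nat.cast_nonneg n)⟩
    exact Submodule.sub_mem _ (hB.mem_l2Closure hW h1)
      (hB.mem_l2Closure hW (div_mem_Icc_of_lt hk hi))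
  exact hW.isGaussianSpace_elementarySpace.l2Closure.tendstoInMeasure_sum_sq hmem
    (eventually_gridSum_pos hcont hx₀ hmin k) hmean hcovs

/-- Consistency of the ratio statistic and of the estimator of the minimal Hurst index. -/
theorem IsMultifracBM.tendstoInMeasure_ratioStat [IsProbabilityMeasure P]
    (hW : IsComplexGaussianMeasure P W) (hB : IsMultifracBM P W h B)
    (h_range : ∀ t ∈ Icc (0 : ℝ) 1, h t ∈ Ioo (0 : ℝ) 1)
    (h_smooth : ContDiffOn ℝ 2 h (Icc (0 : ℝ) 1)) :
    TendstoInMeasure P (fun n : ℕ => ratioStat B n) atTop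
        (fun _ => ((1 : ℝ) / 2) ^ (2 * hmin h)) ∧
      TendstoInMeasure P (fun n : ℕ => hminEstimator B n) atTop (fun _ => hmin h) := by
  have hcont := h_smooth.continuousOn
  have hne : (Icc (0 : ℝ) 1).Nonempty := ⟨0, le_rfl, zero_le_one⟩
  obtain ⟨x₀, hx₀, hx₀min⟩ := isCompact_Icc.exists_isMinOn hne hcont
  obtain ⟨x₁, hx₁, hx₁max⟩ := isCompact_Icc.exists_isMaxOn hne hcont
  have hx₀eq : h x₀ = hmin h := by
    have : IsLeast (h '' Icc (0 : ℝ) 1) (h x₀) :=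
      ⟨mem_image_of_mem h hx₀, by rintro _ ⟨t, ht, rfl⟩; exact hx₀min ht⟩
    exact this.csInf_eq.symm
  obtain ⟨K, hK⟩ := h_smooth.exists_lipschitzOnWith two_ne_zero (convex_Icc 0 1) isCompact_Icc
  set α := hmin h with hα_def
  have hα : α ∈ Ioo (0 : ℝ) 1 := hx₀eq ▸ h_range x₀ hx₀
  have hβ : h x₁ < 1 := (h_range x₁ hx₁).2
  have hh : ∀ t ∈ Icc (0 : ℝ) 1, h t ∈ Icc α (h x₁) := fun t ht =>
    ⟨hx₀eq ▸ hx₀min ht, hx₁max ht⟩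
  have hL : ∀ t ∈ Icc (0 : ℝ) 1, ∀ s ∈ Icc (0 : ℝ) 1, |h t - h s| ≤ K * |t - s| :=
    fun t ht s hs => hK.dist_le_mul t ht s hs
  set κ := (1 / normConst α) ^ 2 * (spectralCov 1 0 α).re with hκ_def
  have hκ : 0 < κ :=
    mul_pos (pow_pos (one_div_pos.2 (normConst_pos hα)) 2) (spectralCov_one_zero_pos hα)
  have hV₁ := hB.tendstoInMeasure_quadVar hW hα.1 hβ hh hL hcont hx₀ hx₀eq one_pos
  have hV₂ := hB.tendstoInMeasure_quadVar hW hα.1 hβ hh hL hcont hx₀ hx₀eq two_pos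
  rw [Nat.cast_one, Real.one_rpow, one_mul, ← hκ_def] at hV₁
  rw [Nat.cast_ofNat, ← hκ_def] at hV₂
  have h2α : (0 : ℝ) < 2 ^ (2 * α) := Real.rpow_pos_of_pos two_pos _
  set ρ : ℕ → ℝ := fun n => gridSum h 1 n / gridSum h 2 n with hρ_def
  have hρ : Tendsto ρ atTop (𝓝 1) :=
    tendsto_gridSum_one_div_two hcont hx₀ hx₀eq fun t ht => (hh t ht).1
  have hlimit : κ / (2 ^ (2 * α) * κ) * 1 = (1 / 2 : ℝ) ^ (2 * α) := by
    rw [mul_one, Real.div_rpow zero_le_one zero_le_two, Real.one_rpow]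
    field_simp
  have hg : Tendsto (fun p : ℕ × ℝ × ℝ => p.2.1 / p.2.2 * ρ p.1)
      (atTop ×ˢ 𝓝 (κ, 2 ^ (2 * α) * κ)) (𝓝 ((1 / 2 : ℝ) ^ (2 * α))) := by
    rw [← hlimit]
    have h1 : Tendsto (fun p : ℝ × ℝ => p.1 / p.2) (𝓝 (κ, 2 ^ (2 * α) * κ))
        (𝓝 (κ / (2 ^ (2 * α) * κ))) :=
      (continuousAt_fst.div continuousAt_snd (mul_pos h2α hκ).ne')
    exact (h1.comp tendsto_snd).mul (hρ.comp tendsto_fst)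
  -- also when `V(B; 2)^n` vanishes, where both sides are `0`
  have hratio : ∀ᶠ n : ℕ in atTop, ∀ ω, quadVar B 1 n ω / gridSum h 1 n /
      (quadVar B 2 n ω / gridSum h 2 n) * ρ n = ratioStat B n ω := by
    filter_upwards [eventually_gridSum_pos hcont hx₀ hx₀eq 1,
      eventually_gridSum_pos hcont hx₀ hx₀eq 2] with n h1 h2 ω
    rw [hρ_def, ratioStat, div_div_div_eq, div_mul_div_comm]
    rw [mul_comm (gridSum h 1 n) (quadVar B 2 n ω), mul_right_comm (quadVar B 2 n ω),
      mul_assoc, mul_assoc, mul_comm (gridSum h 2 n), mul_div_mul_right _ _ (by positivity)]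
  refine ⟨?_, ?_⟩
  · refine (tendstoInMeasure_map₂ (g := fun n u v => u / v * ρ n) hV₁ hV₂ hg).congr' ?_
      (ae_eq_refl _)
    filter_upwards [hratio] with n hn
    exact Eventually.of_forall hn
  · have hpos : (0 : ℝ) < (1 / 2 : ℝ) ^ (2 * α) := Real.rpow_pos_of_pos (by norm_num) _
    have hlog : -Real.log ((1 / 2 : ℝ) ^ (2 * α)) / (2 * Real.log 2) = α := by
      have h2 : Real.log 2 ≠ 0 := (Real.log_pos one_lt_two).ne'
      rw [Real.log_rpow (by norm_num), one_div, Real.log_inv]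
      field_simp
    have hg' := ((hg.log hpos.ne').neg).div_const (2 * Real.log 2)
    rw [hlog] at hg'
    refine (tendstoInMeasure_map₂ (g := fun n u v => -Real.log (u / v * ρ n) / (2 * Real.log 2))
      hV₁ hV₂ hg').congr' ?_ (ae_eq_refl _)
    filter_upwards [hratio] with n hn
    refine Eventually.of_forall fun ω => ?_
    simp only [hn ω, hminEstimator]

end Consistency

end MultifracBM

theorem theorem2p6 {Ω : Type*} [MeasurableSpace Ω] (P : Measure Ω) [IsProbabilityMeasure P]
    (W : Set ℝ → Ω → ℂ) (hW : MultifracBM.IsComplexGaussianMeasure P W)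
    (h : ℝ → ℝ) (h_range : ∀ t ∈ Icc (0 : ℝ) 1, h t ∈ Ioo (0 : ℝ) 1)
    (h_smooth : ContDiffOn ℝ 2 h (Icc (0 : ℝ) 1))
    (B : ℝ → Ω → ℝ) (hB : MultifracBM.IsMultifracBM P W h B)
    (q m : ℕ) (a b : Fin q → ℝ) (x : Fin m → ℝ)
    (hM : MultifracBM.MinSetForm h a b x)
    (hA : q = 0 → MultifracBM.ConditionA h x) :
    TendstoInMeasure P (fun n : ℕ => MultifracBM.ratioStat B n) atTop
        (fun _ => ((1 : ℝ) / 2) ^ (2 * MultifracBM.hmin h)) ∧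
      TendstoInMeasure P (fun n : ℕ => MultifracBM.hminEstimator B n) atTop
        (fun _ => MultifracBM.hmin h) :=
  hB.tendstoInMeasure_ratioStat hW h_range h_smooth
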